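/- **Virial bounds for the Gabitov–Turitsyn equation.** Let $d\ge 1$, let $p\ge 2$ be an even integer with $p\ge \frac8d$, and let $\gamma\in\{-1,1\}$. Consider $$ i u_t+\gamma\Delta u+\int_0^1 e^{-i\sigma\Delta}\Big[\big|e^{i\sigma\Delta}u\big|^p\, e^{i\sigma\Delta}u\Big]\,d\sigma=0,\qquad u(0,\cdot)=u_0\in\mathcal S(\mathbb R^d), \tag{GT}$$ and let $u$ be a Schwartz solution on an open interval $I\ni 0$ (for instance the maximal one): $u\in C(I;\mathcal S(\mathbb R^d))$ and (GT) holds at every point of $I\times\mathbb R^d$. Put $$ v(t)=\int_{\mathbb R^d}|x|^2|u(t,x)|^2\,dx,\qquad \dot v_1(t)=4\,\mathrm{Im}\int_{\mathbb R^d}\overline{u(t,x)}\,\big(x\cdot\nabla u(t,x)\big)\,dx, $$ $$ E(u)=-\frac{\gamma}{2}\int_{\mathbb R^d}|\nabla u|^2\,dx+\frac1{p+2}\int_{\mathbb R^d}\int_0^1\big|e^{i\sigma\Delta}u\big|^{p+2}\,d\sigma\,dx . $$ Then $E(u(t))=E(u_0)$ for all $t\in I$; write $E(u)$ for this value. Moreover: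 1. (Defocusing case, $\gamma=-1$.) There is a constant $C(p,d)>0$, depending only on $p$ and $d$, such that for all $t\in I$ with $-\frac12\le t\le 0$, $$ v(t)\le v(0)-\dot v_1(0)\,t+C(p,d)\,E(u)\,t^2 . $$ 2. (Focusing case, $\gamma=1$.) For all $t\in I$ with $t<0$, $$ v(t)\le v(0)+\dot v_1(0)\,t-8E(u)\,t^2 . $$ 3. In both cases, for all $t\in I$ with $t<0$, $$ \dot v_1(t)\ge \dot v_1(0)-16E(u)\,t . $$ -/

import Mathlib

open scoped SchwartzMap FourierTransform InnerProductSpace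

noncomputable section

namespace GabitovTuritsyn

/-- Euclidean space `ℝ^d`. -/
abbrev Space (d : ℕ) : Type := EuclideanSpace ℝ (Fin d)

/-- The free Schrödinger propagator `e^{iσΔ}`, as the Fourier multiplier with symbol
`e^{-iσ|2πξ|²}` (Mathlib's Fourier transform has the kernel `e^{-2πi⟨x,ξ⟩}`, so that `Δ` has the
symbol `-|2πξ|²`). -/
def freePropagator {d : ℕ} (σ : ℝ) (f : Space d → ℂ) : Space d → ℂ :=
  𝓕⁻ (fun ξ : Space d => Complex.exp (-Complex.I * (σ * (2 * Real.pi * ‖ξ‖) ^ 2 : ℝ)) * 𝓕 f ξ)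

/-- The nonlinearity `∫₀¹ e^{-iσΔ} [ |e^{iσΔ} f|^p · e^{iσΔ} f ] dσ`. -/
def nonlinearity {d : ℕ} (p : ℕ) (f : Space d → ℂ) (x : Space d) : ℂ :=
  ∫ σ in (0 : ℝ)..1,
    freePropagator (-σ)
      (fun y => ((‖freePropagator σ f y‖ ^ p : ℝ) : ℂ) * freePropagator σ f y) x

/-- `u` is a solution, on the open time interval `I ∋ 0`, of the Gabitov–Turitsyn equation
`i u_t + γ Δu + ∫₀¹ e^{-iσΔ} [ |e^{iσΔ} u|^p · e^{iσΔ} u ] dσ = 0` with `u(0) = u₀`: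
a continuous curve in the Schwartz space that satisfies the equation, in the form
`u_t = i (γ Δu + ∫₀¹ …)`, at every point of `I × ℝ^d`. The maximal solution is the special case
in which `I` is the maximal interval of existence. -/
structure IsSolution {d : ℕ} (p : ℕ) (γ : ℝ) (u₀ : 𝓢(Space d, ℂ)) (I : Set ℝ)
    (u : ℝ → 𝓢(Space d, ℂ)) : Prop where
  isOpen : IsOpen I
  ordConnected : I.OrdConnected
  zero_mem : (0 : ℝ) ∈ I
  continuousOn : ContinuousOn u I
  initial : u 0 = u₀
  equation : ∀ t ∈ I, ∀ x : Space d,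
    HasDerivAt (fun s => u s x)
      (Complex.I * ((γ : ℂ) * Laplacian.laplacian (u t : Space d → ℂ) x
        + nonlinearity p (u t : Space d → ℂ) x)) t

/-- `∂_j f`. -/
def partialDeriv {d : ℕ} (j : Fin d) (f : Space d → ℂ) (x : Space d) : ℂ :=
  fderiv ℝ f x (EuclideanSpace.single j 1)

/-- The energy
`E(f) = -(γ/2) ∫ |∇f|² dx + 1/(p+2) ∫ ∫₀¹ |e^{iσΔ} f|^{p+2} dσ dx`. -/
def energy {d : ℕ} (p : ℕ) (γ : ℝ) (f : Space d → ℂ) : ℝ :=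
  -(γ / 2) * (∫ x, ∑ j, ‖partialDeriv j f x‖ ^ 2)
    + 1 / ((p : ℝ) + 2) * ∫ x, ∫ σ in (0 : ℝ)..1, ‖freePropagator σ f x‖ ^ (p + 2)

/-- The variance `∫ |x|² |f(x)|² dx`. -/
def variance {d : ℕ} (f : Space d → ℂ) : ℝ :=
  ∫ x, ‖x‖ ^ 2 * ‖f x‖ ^ 2

/-- `v̇₁ = 4 Im ∫ f̄ (x · ∇f) dx`. -/
def vDotOne {d : ℕ} (f : Space d → ℂ) : ℝ :=
  4 * (∫ x : Space d, (starRingEnd ℂ) (f x) * ∑ j, ((x j : ℝ) : ℂ) * partialDeriv j f x).im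

end GabitovTuritsyn

end

/-! Write p = 2q, w = e^{iσΔ}u and F(σ) = ∫ |w|^(2q+2) dx. For a symmetric operator A the flow gives
d/dt Re⟨u, Au⟩ = -2 Im(γ⟨Au, Δu⟩ + ∫₀¹ ⟨e^{iσΔ}Au, |w|^(2q) w⟩ dσ); this is
`IsSolution.hasDerivAt_quadratic`, applied to |x|², to the dilation generator and to Δ.

The nonlocal term is computed from e^{iσΔ} x_j = (x_j + 2iσ∂_j) e^{iσΔ} (`U_X`). Moving e^{iσΔ} to
the right turns A into a combination of |x|², x·∇, constants and Δ acting on w. Paired with |w|^(2q)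
w, the multiplier |x|² has no imaginary part, x·∇ yields a multiple of F, and Δ yields F'(σ)/(2q+2).
Integration by parts in σ then leaves a boundary term F(1): v' = γ v̇₁ + 8[(dq-2) ∫₀¹ σF dσ +
F(1)]/(2q+2), v̇₁' = -16E - 8[(dq-4) ∫₀¹ F dσ + 2F(1)]/(2q+2).

The condition p ≥ 8/d says dq ≥ 4, so both brackets are nonnegative. Integrating the second identity
from t < 0 to 0 bounds v̇₁ from below, and inserting this in the first gives the focusing estimate.
In the defocusing case v̇₁ must be bounded from above instead: there ∫₀¹ F/(2q+2) ≤ E, while F(1),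
which the energy does not control, is absorbed by the F(1) in v' as long as |t| ≤ 1/2.

The solution is only continuous into the Schwartz space and differentiable pointwise in x. Schwartz
bounds uniform over compact time intervals supply the integrable majorants for every differentiation
under the integral. -/

noncomputable section

namespace GabitovTuritsyn

open MeasureTheory SchwartzMap Bornology

variable {d : ℕ} {ι : Type*}

/-! ### Bounded families of Schwartz functions -/

/-- A family of Schwartz functions that is bounded for every Schwartz seminorm. -/
def BoundedFamily (f : ι → 𝓢(Space d, ℂ)) : Prop :=
  ∀ k n : ℕ, ∃ C : ℝ, ∀ i x, (1 + ‖x‖) ^ k * ‖iteratedFDeriv ℝ n (f i) x‖ ≤ C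

/-- Von Neumann boundedness is stable under continuous linear maps and holds for compact sets, so
both facts transfer to the concrete weighted bounds. -/
lemma boundedFamily_iff_isVonNBounded (f : ι → 𝓢(Space d, ℂ)) :
    BoundedFamily f ↔ IsVonNBounded ℝ (Set.range f) := by
  rw [(schwartz_withSeminorms ℝ (Space d) ℂ).isVonNBounded_iff_finset_seminorm_bounded]
  constructor
  · intro h s
    choose C hC using h
    have hC0 : ∀ k n, ∀ i, SchwartzMap.seminorm ℝ k n (f i) ≤ max (C k n) 0 := by
      intro k n i
      refine seminorm_le_bound ℝ k n (f i) (le_max_right _ _) fun x => ?_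
      refine le_trans ?_ ((hC k n i x).trans (le_max_left _ _))
      gcongr
      linarith
    refine ⟨(∑ m ∈ s, max (C m.1 m.2) 0) + 1, by positivity, ?_⟩
    rintro _ ⟨i, rfl⟩
    refine lt_of_le_of_lt ?_ (lt_add_one _)
    refine Seminorm.finset_sup_apply_le (by positivity) fun m hm => ?_
    refine (hC0 m.1 m.2 i).trans ?_
    exact Finset.single_le_sum (f := fun m : ℕ × ℕ => max (C m.1 m.2) 0)
      (fun _ _ => le_max_right _ _) hm
  · intro h k n
    obtain ⟨r, hr, hb⟩ := h (Finset.Iic (k, n))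
    refine ⟨2 ^ k * r, fun i x => ?_⟩
    refine (one_add_le_sup_seminorm_apply (𝕜 := ℝ) (m := (k, n)) le_rfl le_rfl (f i) x).trans ?_
    gcongr
    exact (hb _ ⟨i, rfl⟩).le

lemma BoundedFamily.clm {f : ι → 𝓢(Space d, ℂ)} (hf : BoundedFamily f)
    (L : 𝓢(Space d, ℂ) →L[ℝ] 𝓢(Space d, ℂ)) : BoundedFamily fun i => L (f i) := by
  rw [boundedFamily_iff_isVonNBounded] at hf ⊢
  have := hf.image L
  rwa [← Set.range_comp] at this

lemma BoundedFamily.clmComplex {f : ι → 𝓢(Space d, ℂ)} (hf : BoundedFamily f)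
    (L : 𝓢(Space d, ℂ) →L[ℂ] 𝓢(Space d, ℂ)) : BoundedFamily fun i => L (f i) :=
  hf.clm (L.restrictScalars ℝ)

lemma BoundedFamily.comp {κ : Type*} {f : ι → 𝓢(Space d, ℂ)} (hf : BoundedFamily f)
    (e : κ → ι) : BoundedFamily fun i => f (e i) := fun k n =>
  (hf k n).imp fun _ hC i x => hC (e i) x

lemma BoundedFamily.decay {f : ι → 𝓢(Space d, ℂ)} (hf : BoundedFamily f) (k : ℕ) :
    ∃ C : ℝ, 0 ≤ C ∧ ∀ i x, (1 + ‖x‖) ^ k * ‖f i x‖ ≤ C := by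
  obtain ⟨C, hC⟩ := hf k 0
  refine ⟨max C 0, le_max_right _ _, fun i x => le_max_of_le_left ?_⟩
  simpa using hC i x

lemma boundedFamily_const (f : 𝓢(Space d, ℂ)) : BoundedFamily fun _ : ι => f := by
  rw [boundedFamily_iff_isVonNBounded]
  exact (isVonNBounded_singleton f).subset Set.range_const_subset

lemma boundedFamily_of_isCompact {X : Type*} [TopologicalSpace X] {K : Set X} (hK : IsCompact K)
    {f : X → 𝓢(Space d, ℂ)} (hf : ContinuousOn f K) : BoundedFamily fun i : K => f i := by
  rw [boundedFamily_iff_isVonNBounded]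
  have := (hK.image_of_continuousOn hf).isVonNBounded ℝ
  rwa [Set.image_eq_range] at this

/-- Multiplication by functions of temperate growth, uniformly over the family. -/
lemma BoundedFamily.mul_left {f h : ι → 𝓢(Space d, ℂ)} (hf : BoundedFamily f)
    {g : ι → Space d → ℂ} (hg : ∀ i, ContDiff ℝ (⊤ : ℕ∞) (g i))
    (hgb : ∀ n : ℕ, ∃ (k : ℕ) (C : ℝ), 0 ≤ C ∧
      ∀ i x, ‖iteratedFDeriv ℝ n (g i) x‖ ≤ C * (1 + ‖x‖) ^ k)
    (hh : ∀ i x, h i x = g i x * f i x) : BoundedFamily h := by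
  intro k n
  choose l C hC0 hC using hgb
  choose B hB using hf
  refine ⟨∑ i ∈ Finset.range (n + 1), (n.choose i : ℝ) * C i * B (k + l i) (n - i),
    fun j x => ?_⟩
  have h1 : (h j : Space d → ℂ) = fun y => g j y * f j y := funext (hh j)
  rw [h1]
  have h2 := norm_iteratedFDeriv_mul_le (𝕜 := ℝ) (hg j) ((f j).smooth ⊤) x (n := n)
    (mod_cast le_top)
  grw [h2]
  rw [Finset.mul_sum]
  refine Finset.sum_le_sum fun i _ => ?_
  grw [hC i j x]
  calc _ = (n.choose i : ℝ) * C i *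
        ((1 + ‖x‖) ^ (k + l i) * ‖iteratedFDeriv ℝ (n - i) (f j) x‖) := by
          rw [pow_add]; ring
    _ ≤ _ := by
      have := hC0 i
      gcongr
      exact hB _ _ j x

/-- The product of two Schwartz functions. -/
def mulS (f g : 𝓢(Space d, ℂ)) : 𝓢(Space d, ℂ) := pairing (ContinuousLinearMap.mul ℂ ℂ) f g

@[simp] lemma mulS_apply (f g : 𝓢(Space d, ℂ)) (x : Space d) : mulS f g x = f x * g x := rfl

lemma BoundedFamily.mulS {f g : ι → 𝓢(Space d, ℂ)} (hf : BoundedFamily f)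
    (hg : BoundedFamily g) : BoundedFamily fun i => mulS (f i) (g i) := by
  refine hg.mul_left (g := fun i => f i) (fun i => (f i).smooth ⊤) (fun n => ?_) fun i x => rfl
  obtain ⟨C, hC⟩ := hf 0 n
  refine ⟨0, max C 0, le_max_right _ _, fun i x => ?_⟩
  have := hC i x
  simp only [pow_zero, one_mul, mul_one] at this ⊢
  exact this.trans (le_max_left _ _)

/-- Complex conjugation on Schwartz functions. -/
def conjS : 𝓢(Space d, ℂ) →L[ℝ] 𝓢(Space d, ℂ) :=
  postcompCLM (Complex.conjCLE : ℂ →L[ℝ] ℂ)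

@[simp] lemma conjS_apply (f : 𝓢(Space d, ℂ)) (x : Space d) :
    conjS f x = (starRingEnd ℂ) (f x) := rfl

/-- The Schwartz function `|f|^(2q) f`. -/
def powS (q : ℕ) (f : 𝓢(Space d, ℂ)) : 𝓢(Space d, ℂ) :=
  (fun g => mulS (mulS f (conjS f)) g)^[q] f

lemma powS_apply (q : ℕ) (f : 𝓢(Space d, ℂ)) (x : Space d) :
    powS q f x = ((‖f x‖ ^ (2 * q) : ℝ) : ℂ) * f x := by
  induction q with
  | zero => simp [powS]
  | succ q ih =>
    simp only [powS] at ih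
    rw [powS, Function.iterate_succ_apply', mulS_apply, ih, mulS_apply, conjS_apply,
      Complex.mul_conj, Complex.normSq_eq_norm_sq]
    push_cast
    ring

lemma BoundedFamily.powS {f : ι → 𝓢(Space d, ℂ)} (hf : BoundedFamily f) (q : ℕ) :
    BoundedFamily fun i => powS q (f i) := by
  induction q with
  | zero => simpa [GabitovTuritsyn.powS] using hf
  | succ q ih =>
    simp only [GabitovTuritsyn.powS, Function.iterate_succ_apply'] at ih ⊢
    exact (hf.mulS (hf.clm conjS)).mulS ih

/-! ### The free propagator on Schwartz functions -/

/-- The symbol `e^{-iσ|2πξ|²}` of `e^{iσΔ}`. -/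
def symbol (σ : ℝ) (ξ : Space d) : ℂ :=
  Complex.exp (-Complex.I * (σ * (2 * Real.pi * ‖ξ‖) ^ 2 : ℝ))

lemma norm_symbol (σ : ℝ) (ξ : Space d) : ‖symbol σ ξ‖ = 1 := by
  rw [symbol, neg_mul, ← mul_neg, mul_comm, ← Complex.ofReal_neg, Complex.norm_exp_ofReal_mul_I]

lemma conj_symbol (σ : ℝ) (ξ : Space d) : (starRingEnd ℂ) (symbol σ ξ) = symbol (-σ) ξ := by
  rw [symbol, symbol, ← Complex.exp_conj, map_mul, Complex.conj_ofReal]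
  simp

lemma symbol_add (σ τ : ℝ) (ξ : Space d) : symbol (σ + τ) ξ = symbol σ ξ * symbol τ ξ := by
  rw [symbol, symbol, symbol, ← Complex.exp_add]
  push_cast
  ring_nf

lemma contDiff_cexp_neg_I : ContDiff ℝ (⊤ : ℕ∞) fun r : ℝ => Complex.exp (-Complex.I * (r : ℂ)) :=
  (contDiff_const.mul Complex.ofRealCLM.contDiff).cexp

lemma norm_iteratedFDeriv_cexp_neg_I (n : ℕ) (r : ℝ) :
    ‖iteratedFDeriv ℝ n (fun r : ℝ => Complex.exp (-Complex.I * (r : ℂ))) r‖ ≤ 1 := by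
  rw [norm_iteratedFDeriv_eq_norm_iteratedDeriv]
  have h : iteratedDeriv n (fun r : ℝ => Complex.exp (-Complex.I * (r : ℂ)))
      = fun r : ℝ => (-Complex.I) ^ n * Complex.exp (-Complex.I * (r : ℂ)) := by
    induction n with
    | zero => simp
    | succ n ih =>
      rw [iteratedDeriv_succ, ih]
      ext r
      have h1 : HasDerivAt (fun r : ℝ => -Complex.I * (r : ℂ)) (-Complex.I * 1) r :=
        (Complex.ofRealCLM.hasDerivAt (x := r)).const_mul _
      rw [(h1.cexp.const_mul _).deriv]
      ring
  rw [h, norm_mul, norm_pow, norm_neg, Complex.norm_I, one_pow, one_mul, neg_mul, ← mul_neg,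
    mul_comm, ← Complex.ofReal_neg, Complex.norm_exp_ofReal_mul_I]

lemma hasTemperateGrowth_phase :
    (fun ξ : Space d => (2 * Real.pi * ‖ξ‖) ^ 2).HasTemperateGrowth := by
  have : (fun ξ : Space d => (2 * Real.pi * ‖ξ‖) ^ 2) =
      fun ξ => (2 * Real.pi) ^ 2 * ‖ξ‖ ^ 2 := by ext; ring
  rw [this]
  fun_prop

lemma contDiff_symbol (σ : ℝ) : ContDiff ℝ (⊤ : ℕ∞) (symbol σ : Space d → ℂ) :=
  contDiff_cexp_neg_I.comp (contDiff_const.mul hasTemperateGrowth_phase.1)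

/-- Faà di Bruno: the outer exponential has all derivatives bounded by 1 and the phase is σ times a
fixed polynomial. What matters is that the bound is uniform for σ in a compact interval. -/
lemma norm_iteratedFDeriv_symbol_le (R : ℝ) (n : ℕ) : ∃ (k : ℕ) (C : ℝ), 0 ≤ C ∧
    ∀ (σ : Set.Icc (-R) R) (ξ : Space d),
      ‖iteratedFDeriv ℝ n (symbol (σ : ℝ) : Space d → ℂ) ξ‖ ≤ C * (1 + ‖ξ‖) ^ k := by
  obtain ⟨k, C, hC, h⟩ := (hasTemperateGrowth_phase (d := d)).norm_iteratedFDeriv_le_uniform n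
  -- The summand 1 makes the base at least 1, so that a bound by D implies the bound by D ^ i, i ≥
  -- 1, that the composition estimate asks for.
  refine ⟨k * n, n.factorial * 1 * (1 + |R| * C) ^ n, by positivity, fun σ ξ => ?_⟩
  have hσ : |(σ : ℝ)| ≤ |R| := by
    rw [abs_le]; exact ⟨by linarith [σ.2.1, le_abs_self R], σ.2.2.trans (le_abs_self R)⟩
  have key := norm_iteratedFDeriv_comp_le (𝕜 := ℝ) (n := n) contDiff_cexp_neg_I
    (contDiff_const (c := (σ : ℝ)).mul (hasTemperateGrowth_phase (d := d)).1) (mod_cast le_top) ξ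
    (C := 1) (D := (1 + |R| * C) * (1 + ‖ξ‖) ^ k)
    (fun i _ => norm_iteratedFDeriv_cexp_neg_I i _) (fun i hi hin => ?_)
  · rw [mul_pow, ← pow_mul, ← mul_assoc] at key
    exact key
  · have h1 : iteratedFDeriv ℝ i (fun ξ : Space d => (σ : ℝ) * (2 * Real.pi * ‖ξ‖) ^ 2) ξ
        = (σ : ℝ) • iteratedFDeriv ℝ i (fun ξ : Space d => (2 * Real.pi * ‖ξ‖) ^ 2) ξ :=
      iteratedFDeriv_const_smul_apply (a := (σ : ℝ))
        ((hasTemperateGrowth_phase (d := d)).1.contDiffAt.of_le (mod_cast le_top))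
    rw [h1, norm_smul, Real.norm_eq_abs]
    have h2 : (1 : ℝ) ≤ (1 + ‖ξ‖) ^ k := one_le_pow₀ (by linarith [norm_nonneg ξ])
    calc _ ≤ |R| * (C * (1 + ‖ξ‖) ^ k) := by gcongr; exact h i hin ξ
      _ ≤ (1 + |R| * C) * (1 + ‖ξ‖) ^ k := by linarith
      _ ≤ _ := by
        refine le_self_pow₀ (one_le_mul_of_one_le_of_one_le ?_ h2) (by omega)
        have : 0 ≤ |R| * C := by positivity
        linarith

lemma hasTemperateGrowth_symbol (σ : ℝ) : (symbol σ : Space d → ℂ).HasTemperateGrowth := by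
  refine ⟨contDiff_symbol σ, fun n => ?_⟩
  obtain ⟨k, C, -, h⟩ := norm_iteratedFDeriv_symbol_le (d := d) |σ| n
  exact ⟨k, C, h ⟨σ, neg_abs_le σ, le_abs_self σ⟩⟩

/-- The free propagator as an operator on the Schwartz space. -/
def U (σ : ℝ) : 𝓢(Space d, ℂ) →L[ℂ] 𝓢(Space d, ℂ) := fourierMultiplierCLM ℂ (symbol σ)

lemma U_eq_freePropagator (σ : ℝ) (f : 𝓢(Space d, ℂ)) :
    (U σ f : Space d → ℂ) = freePropagator σ f := by
  rw [U, fourierMultiplierCLM_apply, fourierInv_coe,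
    smulLeftCLM_apply (hasTemperateGrowth_symbol σ)]
  rfl

lemma BoundedFamily.U {R : ℝ} {s : ι → ℝ} (hs : ∀ i, s i ∈ Set.Icc (-R) R)
    {f : ι → 𝓢(Space d, ℂ)} (hf : BoundedFamily f) : BoundedFamily fun i => U (s i) (f i) := by
  have h1 : BoundedFamily fun i => 𝓕 (f i) := hf.clm (FourierTransform.fourierCLM ℝ _)
  have h2 : BoundedFamily fun i => smulLeftCLM ℂ (symbol (s i)) (𝓕 (f i)) := by
    refine h1.mul_left (g := fun i => symbol (s i)) (fun i => contDiff_symbol _) (fun n => ?_)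
      fun i x => ?_
    · obtain ⟨k, C, hC, h⟩ := norm_iteratedFDeriv_symbol_le (d := d) R n
      exact ⟨k, C, hC, fun i x => h ⟨s i, hs i⟩ x⟩
    · rw [smulLeftCLM_apply_apply (hasTemperateGrowth_symbol _), smul_eq_mul]
  exact h2.clm (FourierTransform.fourierInvCLM ℝ _)

/-! ### Position and momentum operators -/

lemma hasTemperateGrowth_coord (j : Fin d) :
    (fun x : Space d => ((x j : ℝ) : ℂ)).HasTemperateGrowth :=
  (Complex.ofRealCLM.comp (EuclideanSpace.proj j : Space d →L[ℝ] ℝ)).hasTemperateGrowth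

/-- Multiplication by the coordinate `x_j`. -/
def X (j : Fin d) : 𝓢(Space d, ℂ) →L[ℂ] 𝓢(Space d, ℂ) :=
  smulLeftCLM ℂ fun x : Space d => ((x j : ℝ) : ℂ)

@[simp] lemma X_apply (j : Fin d) (f : 𝓢(Space d, ℂ)) (x : Space d) :
    X j f x = ((x j : ℝ) : ℂ) * f x := by
  rw [X, smulLeftCLM_apply_apply (hasTemperateGrowth_coord j), smul_eq_mul]

/-- The partial derivative `∂_j`. -/
def D (j : Fin d) : 𝓢(Space d, ℂ) →L[ℂ] 𝓢(Space d, ℂ) :=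
  LineDeriv.lineDerivOpCLM ℂ 𝓢(Space d, ℂ) (EuclideanSpace.single j (1 : ℝ) : Space d)

open LineDeriv in
lemma D_eq (j : Fin d) (f : 𝓢(Space d, ℂ)) :
    D j f = ∂_{(EuclideanSpace.single j (1 : ℝ) : Space d)} f := rfl

lemma D_apply (j : Fin d) (f : 𝓢(Space d, ℂ)) (x : Space d) :
    D j f x = partialDeriv j f x := rfl

/-- The Laplacian. -/
def Lap : 𝓢(Space d, ℂ) →L[ℂ] 𝓢(Space d, ℂ) := ∑ j, D j ∘L D j

lemma Lap_eq_sum (f : 𝓢(Space d, ℂ)) : Lap f = ∑ j, D j (D j f) := by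
  simp [Lap]

lemma Lap_apply (f : 𝓢(Space d, ℂ)) (x : Space d) :
    Lap f x = Laplacian.laplacian (f : Space d → ℂ) x := by
  rw [← laplacian_apply, laplacian_eq_sum (EuclideanSpace.basisFun (Fin d) ℝ), Lap_eq_sum]
  simp [D_eq]

lemma D_X (j k : Fin d) (f : 𝓢(Space d, ℂ)) :
    D j (X k f) = X k (D j f) + if j = k then f else 0 := by
  ext x
  have h1 : HasFDerivAt (fun x : Space d => ((x k : ℝ) : ℂ))
      (Complex.ofRealCLM.comp (EuclideanSpace.proj k : Space d →L[ℝ] ℝ)) x :=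
    (Complex.ofRealCLM.comp (EuclideanSpace.proj k : Space d →L[ℝ] ℝ)).hasFDerivAt
  have h2 := h1.mul (f.hasFDerivAt x)
  have h3 : (X k f : Space d → ℂ) = fun x => ((x k : ℝ) : ℂ) * f x := by ext; simp
  rw [D_apply, partialDeriv, h3]
  erw [h2.fderiv]
  rw [add_apply (X k (D j f)), X_apply, D_apply, partialDeriv]
  by_cases hjk : j = k
  · subst hjk
    simp
  · simp [hjk, Ne.symm hjk]

lemma X_X_comm (j k : Fin d) (f : 𝓢(Space d, ℂ)) : X j (X k f) = X k (X j f) := by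
  ext x; simp; ring

lemma smulLeftCLM_inner_single (j : Fin d) (f : 𝓢(Space d, ℂ)) :
    smulLeftCLM ℂ (fun x : Space d => inner ℝ x (EuclideanSpace.single j (1 : ℝ) : Space d)) f =
      X j f := by
  ext x
  rw [smulLeftCLM_apply_apply (by fun_prop), X_apply]
  simp [EuclideanSpace.inner_single_right]

lemma fourier_D (j : Fin d) (f : 𝓢(Space d, ℂ)) :
    𝓕 (D j f) = (2 * Real.pi * Complex.I) • X j (𝓕 f) := by
  rw [D_eq, fourier_lineDerivOp_eq, smulLeftCLM_inner_single]

open LineDeriv in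
lemma U_D (σ : ℝ) (j : Fin d) (f : 𝓢(Space d, ℂ)) : U σ (D j f) = D j (U σ f) := by
  have h1 : U σ (D j f) = 𝓕⁻ (smulLeftCLM ℂ (symbol σ) (𝓕 (D j f))) := rfl
  have h2 : U σ f = 𝓕⁻ (smulLeftCLM ℂ (symbol σ) (𝓕 f)) := rfl
  rw [h1, h2, fourier_D, D_eq, lineDerivOp_fourierInv_eq, smulLeftCLM_inner_single]
  congr 1
  ext x
  simp only [smulLeftCLM_apply_apply (hasTemperateGrowth_symbol σ), X_apply, smul_apply,
    smul_eq_mul]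
  ring

lemma U_Lap (σ : ℝ) (f : 𝓢(Space d, ℂ)) : U σ (Lap f) = Lap (U σ f) := by
  simp [Lap_eq_sum, U_D]

lemma fderiv_symbol (σ : ℝ) (ξ : Space d) (j : Fin d) :
    fderiv ℝ (symbol σ : Space d → ℂ) ξ (EuclideanSpace.single j (1 : ℝ)) =
      -(8 * Real.pi ^ 2 * Complex.I * σ) * ((ξ j : ℝ) : ℂ) * symbol σ ξ := by
  have h1 := (hasStrictFDerivAt_norm_sq ξ).hasFDerivAt
  have h2 : HasFDerivAt (fun ξ : Space d => σ * (2 * Real.pi * ‖ξ‖) ^ 2)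
      ((σ * (2 * Real.pi) ^ 2) • (2 • (innerSL ℝ ξ))) ξ := by
    convert! h1.const_mul (σ * (2 * Real.pi) ^ 2) using 1
    ext; ring
  have h3 := ((Complex.ofRealCLM.hasFDerivAt.comp ξ h2).const_mul (-Complex.I)).cexp
  have h4 : (fun x : Space d => Complex.exp (-Complex.I *
      (Complex.ofRealCLM ∘ fun ξ : Space d => σ * (2 * Real.pi * ‖ξ‖) ^ 2) x)) = symbol σ := rfl
  rw [h4] at h3
  rw [h3.fderiv]
  simp [symbol, EuclideanSpace.inner_single_right]
  ring

-- On the Fourier side x_j is differentiation in ξ_j up to a constant, and differentiating the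
-- symbol produces the extra factor -8π²iσ ξ_j, which transforms back to a multiple of ∂_j. This is
-- the Galilean operator x + 2iσ∇.
open LineDeriv FourierTransform in
lemma U_X (σ : ℝ) (j : Fin d) (f : 𝓢(Space d, ℂ)) :
    U σ (X j f) = X j (U σ f) + (2 * Complex.I * σ) • D j (U σ f) := by
  set e : Space d := EuclideanSpace.single j (1 : ℝ) with he
  have hX : ∀ g : 𝓢(Space d, ℂ), smulLeftCLM ℂ (fun x : Space d => inner ℝ x e) g = X j g :=
    smulLeftCLM_inner_single j
  set g := smulLeftCLM ℂ (symbol σ) (𝓕 f) with hg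
  have hgx : ∀ x, g x = symbol σ x * 𝓕 f x := fun x => by
    rw [hg, smulLeftCLM_apply_apply (hasTemperateGrowth_symbol σ), smul_eq_mul]
  have hU : U σ f = 𝓕⁻ g := rfl
  have hD : D j (U σ f) = 𝓕⁻ ((2 * Real.pi * Complex.I) • X j g) := by
    rw [hU, D_eq, lineDerivOp_fourierInv_eq, hX]
  have hXU : 𝓕⁻ (∂_{e} g) = -(2 * Real.pi * Complex.I) • X j (U σ f) := by
    rw [fourierInv_lineDerivOp_eq, hX, hU]
  have hUX : U σ (-(2 * Real.pi * Complex.I) • X j f) =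
      𝓕⁻ (smulLeftCLM ℂ (symbol σ) (∂_{e} (𝓕 f))) := by
    rw [lineDerivOp_fourier_eq, hX]; rfl
  have key : ∂_{e} g = (-(8 * Real.pi ^ 2 * Complex.I * σ) : ℂ) • X j g +
      smulLeftCLM ℂ (symbol σ) (∂_{e} (𝓕 f)) := by
    ext x
    have h1 : HasFDerivAt (symbol σ : Space d → ℂ) _ x :=
      ((contDiff_symbol σ).differentiable (by simp) x).hasFDerivAt
    have h2 := h1.mul ((𝓕 f).hasFDerivAt x)
    have h3 : (g : Space d → ℂ) = fun x => symbol σ x * 𝓕 f x := funext hgx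
    rw [add_apply, smul_apply,
      smulLeftCLM_apply_apply (hasTemperateGrowth_symbol σ), X_apply,
      lineDerivOp_apply_eq_fderiv, lineDerivOp_apply_eq_fderiv, h3]
    erw [h2.fderiv]
    simp only [add_apply, smul_apply, smul_eq_mul]
    rw [he, fderiv_symbol]
    ring
  have h5 := congrArg (fun g => 𝓕⁻ g) key
  rw [hXU, fourierInv_add, ← hUX, map_smul] at h5
  have h6 : 𝓕⁻ ((-(8 * Real.pi ^ 2 * Complex.I * σ) : ℂ) • X j g) =
      (-(4 * Real.pi * σ) : ℂ) • D j (U σ f) := by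
    rw [hD, ← fourierInv_smul, smul_smul]
    congr 2
    ring
  rw [h6] at h5
  have hpi : (-(2 * Real.pi * Complex.I) : ℂ) ≠ 0 := by
    simp [Real.pi_ne_zero]
  have h7 : (-(2 * Real.pi * Complex.I) : ℂ) • U σ (X j f) =
      (-(2 * Real.pi * Complex.I) : ℂ) • (X j (U σ f) + (2 * Complex.I * σ) • D j (U σ f)) := by
    rw [smul_add, h5, smul_smul, add_right_comm, ← add_smul]
    have : (-(4 * Real.pi * σ) : ℂ) + -(2 * Real.pi * Complex.I) * (2 * Complex.I * σ) = 0 := by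
      linear_combination (-(4 * Real.pi * σ) : ℂ) * Complex.I_sq
    rw [this, zero_smul, zero_add]
  exact smul_right_injective _ hpi h7

/-! ### The `L²` pairing of Schwartz functions -/

/-- The pairing `∫ conj f * g`. -/
def ip (f g : 𝓢(Space d, ℂ)) : ℂ := ∫ x, (starRingEnd ℂ) (f x) * g x

lemma integrable_conj_mul (f g : 𝓢(Space d, ℂ)) :
    Integrable fun x => (starRingEnd ℂ) (f x) * g x :=
  (mulS (conjS f) g).integrable

lemma ip_add_left (f g h : 𝓢(Space d, ℂ)) : ip (f + g) h = ip f h + ip g h := by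
  rw [ip, ip, ip, ← integral_add (integrable_conj_mul _ _) (integrable_conj_mul _ _)]
  simp [add_mul]

lemma ip_add_right (f g h : 𝓢(Space d, ℂ)) : ip f (g + h) = ip f g + ip f h := by
  rw [ip, ip, ip, ← integral_add (integrable_conj_mul _ _) (integrable_conj_mul _ _)]
  simp [mul_add]

lemma ip_smul_left (c : ℂ) (f g : 𝓢(Space d, ℂ)) : ip (c • f) g = (starRingEnd ℂ) c * ip f g := by
  rw [ip, ip, ← integral_const_mul]
  simp [mul_assoc]

lemma ip_smul_right (c : ℂ) (f g : 𝓢(Space d, ℂ)) : ip f (c • g) = c * ip f g := by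
  rw [ip, ip, ← integral_const_mul]
  congr 1; ext x; simp; ring

lemma ip_conj (f g : 𝓢(Space d, ℂ)) : (starRingEnd ℂ) (ip f g) = ip g f := by
  rw [ip, ip, ← integral_conj]
  congr 1; ext x; simp; ring

lemma ip_re_comm (f g : 𝓢(Space d, ℂ)) : (ip f g).re = (ip g f).re := by
  rw [← ip_conj g f, Complex.conj_re]

lemma ip_im_comm (f g : 𝓢(Space d, ℂ)) : (ip f g).im = -(ip g f).im := by
  rw [← ip_conj g f, Complex.conj_im]

lemma ip_self_im (f : 𝓢(Space d, ℂ)) : (ip f f).im = 0 := by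
  have := ip_im_comm f f
  linarith

lemma ip_zero_left (g : 𝓢(Space d, ℂ)) : ip 0 g = 0 := by simp [ip]

lemma ip_zero_right (g : 𝓢(Space d, ℂ)) : ip g 0 = 0 := by simp [ip]

lemma ip_sum_left (s : Finset ι) (f : ι → 𝓢(Space d, ℂ)) (g : 𝓢(Space d, ℂ)) :
    ip (∑ i ∈ s, f i) g = ∑ i ∈ s, ip (f i) g := by
  classical
  induction s using Finset.induction_on with
  | empty => simp [ip_zero_left]
  | insert i s hi ih => rw [Finset.sum_insert hi, Finset.sum_insert hi, ip_add_left, ih]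

lemma ip_sum_right (s : Finset ι) (f : ι → 𝓢(Space d, ℂ)) (g : 𝓢(Space d, ℂ)) :
    ip g (∑ i ∈ s, f i) = ∑ i ∈ s, ip g (f i) := by
  classical
  induction s using Finset.induction_on with
  | empty => simp [ip_zero_right]
  | insert i s hi ih => rw [Finset.sum_insert hi, Finset.sum_insert hi, ip_add_right, ih]

lemma ip_X (j : Fin d) (f g : 𝓢(Space d, ℂ)) : ip (X j f) g = ip f (X j g) := by
  rw [ip, ip]
  congr 1; ext x; simp; ring

lemma conjS_D (j : Fin d) (f : 𝓢(Space d, ℂ)) : D j (conjS f) = conjS (D j f) := by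
  ext x
  have h : HasFDerivAt (conjS f : Space d → ℂ) _ x :=
    (Complex.conjCLE : ℂ →L[ℝ] ℂ).hasFDerivAt.comp x (f.hasFDerivAt x)
  rw [D_apply, partialDeriv, h.fderiv]
  simp [D_apply, partialDeriv]

lemma ip_D (j : Fin d) (f g : 𝓢(Space d, ℂ)) : ip (D j f) g = -ip f (D j g) := by
  have h := integral_mul_lineDerivOp_right_eq_neg_left (μ := volume) (conjS f) g
    (EuclideanSpace.single j (1 : ℝ) : Space d)
  rw [← D_eq, ← D_eq, conjS_D] at h
  simp only [conjS_apply] at h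
  rw [ip, ip, h, neg_neg]

-- Plancherel, since conjugating the symbol reverses the sign of σ.
open FourierTransform in
lemma ip_U (σ : ℝ) (f g : 𝓢(Space d, ℂ)) : ip (U σ f) g = ip f (U (-σ) g) := by
  have hp : ∀ a b : 𝓢(Space d, ℂ), ip (𝓕 a) (𝓕 b) = ip a b := fun a b => by
    have := integral_inner_fourier_fourier a b
    simp only [RCLike.inner_apply] at this
    rw [ip, ip]
    simpa only [mul_comm] using this
  rw [← hp (U σ f), ← hp f]
  have hU : ∀ (τ : ℝ) (a : 𝓢(Space d, ℂ)), 𝓕 (U τ a) = smulLeftCLM ℂ (symbol τ) (𝓕 a) := by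
    intro τ a
    rw [U, fourierMultiplierCLM_apply, fourier_fourierInv_eq]
  rw [hU, hU, ip, ip]
  congr 1; ext x
  rw [smulLeftCLM_apply_apply (hasTemperateGrowth_symbol _),
    smulLeftCLM_apply_apply (hasTemperateGrowth_symbol _), smul_eq_mul, smul_eq_mul, map_mul,
    conj_symbol]
  ring

lemma ip_U_U (σ : ℝ) (f g : 𝓢(Space d, ℂ)) : ip (U σ f) (U σ g) = ip f g := by
  rw [ip_U]
  congr 1
  rw [U, U, fourierMultiplierCLM_fourierMultiplierCLM_apply (hasTemperateGrowth_symbol _)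
    (hasTemperateGrowth_symbol _)]
  have : (symbol (-σ) * symbol σ : Space d → ℂ) = fun _ => 1 := by
    ext x
    rw [Pi.mul_apply, ← symbol_add]
    simp [symbol]
  rw [this]; simp

/-! ### The symmetric operators of the virial identities -/

/-- Multiplication by `|x|²`. -/
def sqPos : 𝓢(Space d, ℂ) →L[ℂ] 𝓢(Space d, ℂ) := ∑ j, X j ∘L X j

lemma sqPos_eq_sum (f : 𝓢(Space d, ℂ)) : sqPos f = ∑ j, X j (X j f) := by simp [sqPos]

lemma sqPos_apply (f : 𝓢(Space d, ℂ)) (x : Space d) : sqPos f x = ((‖x‖ ^ 2 : ℝ) : ℂ) * f x := by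
  rw [sqPos_eq_sum, sum_apply, EuclideanSpace.norm_sq_eq]
  push_cast
  rw [Finset.sum_mul]
  refine Finset.sum_congr rfl fun j _ => ?_
  rw [X_apply, X_apply, Real.norm_eq_abs]
  rw [← Complex.ofReal_pow, sq_abs]
  push_cast
  ring

/-- The Euler operator `x · ∇`. -/
def euler : 𝓢(Space d, ℂ) →L[ℂ] 𝓢(Space d, ℂ) := ∑ j, X j ∘L D j

lemma euler_eq_sum (f : 𝓢(Space d, ℂ)) : euler f = ∑ j, X j (D j f) := by simp [euler]

/-- The generator `-i (x · ∇ + d/2)` of dilations. -/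
def dilation : 𝓢(Space d, ℂ) →L[ℂ] 𝓢(Space d, ℂ) :=
  (-Complex.I) • (euler + ((d : ℂ) / 2) • ContinuousLinearMap.id ℂ _)

lemma dilation_eq (f : 𝓢(Space d, ℂ)) :
    dilation f = (-Complex.I) • (euler f + ((d : ℂ) / 2) • f) := by simp [dilation]

lemma ip_sqPos (f g : 𝓢(Space d, ℂ)) : ip (sqPos f) g = ip f (sqPos g) := by
  simp [sqPos_eq_sum, ip_sum_left, ip_sum_right, ip_X]

lemma ip_Lap (f g : 𝓢(Space d, ℂ)) : ip (Lap f) g = ip f (Lap g) := by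
  simp [Lap_eq_sum, ip_sum_left, ip_sum_right, ip_D]

lemma ip_euler (f g : 𝓢(Space d, ℂ)) : ip (euler f) g = -ip f (euler g) - d * ip f g := by
  simp only [euler_eq_sum, ip_sum_left, ip_sum_right, ip_X, ip_D, D_X, if_true, ip_add_right]
  simp [Finset.sum_add_distrib]
  ring

/-- The shift d/2 compensates the divergence d of the field x produced by integrating x·∇ by parts.
-/
lemma ip_dilation (f g : 𝓢(Space d, ℂ)) : ip (dilation f) g = ip f (dilation g) := by
  simp only [dilation_eq, ip_smul_left, ip_smul_right, ip_add_left, ip_add_right, ip_euler,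
    map_neg, Complex.conj_I, map_div₀, map_natCast, map_ofNat]
  ring

lemma re_ip_dilation (f : 𝓢(Space d, ℂ)) : (ip f (dilation f)).re = (ip f (euler f)).im := by
  rw [dilation_eq, ip_smul_right, ip_add_right, ip_smul_right]
  simp [ip_self_im]

/-- After one integration by parts, the terms with |x|² intact are real; only the commutators of ∂_k
with x_k² survive. -/
lemma im_ip_sqPos_Lap (f : 𝓢(Space d, ℂ)) :
    (ip (sqPos f) (Lap f)).im = -2 * (ip f (euler f)).im := by
  have h : ∀ j k, (ip (X j (X j f)) (D k (D k f))).im =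
      -2 * if k = j then (ip f (X j (D j f))).im else 0 := by
    intro j k
    have h1 : ip (X j (X j f)) (D k (D k f)) = -ip (D k (X j (X j f))) (D k f) := by
      rw [ip_D, neg_neg]
    rw [h1, D_X, D_X, map_add, ip_add_left, ip_add_left]
    have h2 : (ip (X j (X j (D k f))) (D k f)).im = 0 := by
      rw [ip_X, ip_self_im]
    by_cases hjk : k = j
    · subst hjk
      simp only [if_true, Complex.neg_im, Complex.add_im, h2]
      rw [ip_X]
      ring
    · simp [hjk, h2, ip_zero_left]
  rw [sqPos_eq_sum, Lap_eq_sum, euler_eq_sum, ip_sum_right]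
  simp only [ip_sum_right, ip_sum_left, Complex.im_sum, h]
  simp [Finset.mul_sum]

open FourierTransform in
lemma D_D_comm (j k : Fin d) (f : 𝓢(Space d, ℂ)) : D j (D k f) = D k (D j f) := by
  have hF : 𝓕 (D j (D k f)) = 𝓕 (D k (D j f)) := by
    rw [fourier_D, fourier_D, fourier_D, fourier_D, map_smul, map_smul, X_X_comm]
  simpa using congrArg (fun g : 𝓢(Space d, ℂ) => (𝓕⁻ g : 𝓢(Space d, ℂ))) hF

/-- Since [∂_k, x·∇] = ∂_k and Re⟨x·∇g, g⟩ = -(d/2)‖g‖², the d/2 terms cancel and only the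
commutator remains. -/
lemma im_ip_dilation_Lap (f : 𝓢(Space d, ℂ)) :
    (ip (dilation f) (Lap f)).im = -∑ j, (ip (D j f) (D j f)).re := by
  have hE : ∀ k, D k (euler f) = euler (D k f) + D k f := by
    intro k
    simp only [euler_eq_sum, map_sum, D_X, Finset.sum_add_distrib, D_D_comm k]
    simp
  have hre : ∀ g : 𝓢(Space d, ℂ), (ip (euler g) g).re = -(d / 2 : ℝ) * (ip g g).re := by
    intro g
    have h1 := congrArg Complex.re (ip_euler g g)
    rw [Complex.sub_re, Complex.neg_re, ip_re_comm g (euler g)] at h1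
    simp at h1
    linarith
  rw [dilation_eq, ip_smul_left, ip_add_left, ip_smul_left, Lap_eq_sum, ip_sum_right, ip_sum_right]
  simp only [map_neg, Complex.conj_I, neg_neg, Complex.mul_im, Complex.I_re, Complex.I_im,
    zero_mul, one_mul, zero_add, Complex.add_re, map_div₀, map_natCast,
    map_ofNat]
  have hd : (d : ℂ) / 2 = ((d / 2 : ℝ) : ℂ) := by
    simp
  rw [hd, Complex.re_ofReal_mul, Complex.re_sum, Complex.re_sum, Finset.mul_sum,
    ← Finset.sum_add_distrib, ← Finset.sum_neg_distrib]
  refine Finset.sum_congr rfl fun k _ => ?_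
  have h1 : ip (euler f) (D k (D k f)) = -ip (D k (euler f)) (D k f) := by rw [ip_D, neg_neg]
  have h2 : ip f (D k (D k f)) = -ip (D k f) (D k f) := by rw [ip_D, neg_neg]
  rw [h1, h2, hE, ip_add_left, Complex.neg_re, Complex.add_re, hre, Complex.neg_re]
  ring

/-- The sum over j of (x_j + 2iσ∂_j)², expanded with [∂_j, x_j] = 1. -/
lemma U_sqPos (σ : ℝ) (f : 𝓢(Space d, ℂ)) :
    U σ (sqPos f) = sqPos (U σ f)
      + (2 * Complex.I * σ) • ((2 : ℂ) • euler (U σ f) + (d : ℂ) • U σ f)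
      + (-(4 * σ ^ 2) : ℂ) • Lap (U σ f) := by
  have h : ∀ j, U σ (X j (X j f)) = X j (X j (U σ f)) +
      (2 * Complex.I * σ) • ((2 : ℂ) • X j (D j (U σ f)) + U σ f)
      + (-(4 * σ ^ 2) : ℂ) • D j (D j (U σ f)) := by
    intro j
    rw [U_X, U_X]
    simp only [map_add, map_smul, D_X, if_true, smul_add, smul_smul]
    have : (2 * Complex.I * σ * (2 * Complex.I * σ) : ℂ) = -(4 * σ ^ 2) := by
      linear_combination (4 * σ ^ 2 : ℂ) * Complex.I_sq
    rw [this]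
    module
  rw [sqPos_eq_sum, map_sum, sqPos_eq_sum, euler_eq_sum, Lap_eq_sum]
  simp only [h, Finset.sum_add_distrib, Finset.smul_sum, smul_add]
  simp [smul_smul, mul_comm, ← Nat.cast_smul_eq_nsmul ℂ]

lemma U_dilation (σ : ℝ) (f : 𝓢(Space d, ℂ)) :
    U σ (dilation f) = (-Complex.I) • (euler (U σ f) + ((d : ℂ) / 2) • U σ f
      + (2 * Complex.I * σ) • Lap (U σ f)) := by
  have h : U σ (euler f) = euler (U σ f) + (2 * Complex.I * σ) • Lap (U σ f) := by
    simp only [euler_eq_sum, map_sum, U_X, U_D, Finset.sum_add_distrib, Lap_eq_sum,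
      Finset.smul_sum]
  rw [dilation_eq, map_smul, map_add, map_smul, h]
  congr 1
  module

/-! ### The nonlinear term against the symmetric operators -/

/-- The potential `∫ |f|^(2q+2)`. -/
def potential (q : ℕ) (f : 𝓢(Space d, ℂ)) : ℝ := ∫ x, ‖f x‖ ^ (2 * q + 2)

lemma potential_nonneg (q : ℕ) (f : 𝓢(Space d, ℂ)) : 0 ≤ potential q f :=
  integral_nonneg fun _ => by positivity

lemma conj_mul_powS (q : ℕ) (f : 𝓢(Space d, ℂ)) (x : Space d) :
    (starRingEnd ℂ) (f x) * powS q f x = ((‖f x‖ ^ (2 * q + 2) : ℝ) : ℂ) := by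
  rw [powS_apply, mul_left_comm, Complex.conj_mul', pow_add]
  push_cast
  ring

lemma ip_powS (q : ℕ) (f : 𝓢(Space d, ℂ)) : ip f (powS q f) = (potential q f : ℂ) := by
  rw [ip, potential, ← integral_complex_ofReal]
  simp only [conj_mul_powS]

lemma integrable_potential (q : ℕ) (f : 𝓢(Space d, ℂ)) :
    Integrable fun x => ‖f x‖ ^ (2 * q + 2) := by
  have h := (integrable_conj_mul f (powS q f)).re
  simpa [conj_mul_powS, ← Complex.ofReal_pow] using h

lemma im_ip_sqPos_powS (q : ℕ) (f : 𝓢(Space d, ℂ)) : (ip (sqPos f) (powS q f)).im = 0 := by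
  have h : ip (sqPos f) (powS q f) = ((∫ x : Space d, ‖x‖ ^ 2 * ‖f x‖ ^ (2 * q + 2) : ℝ) : ℂ) := by
    rw [ip, ← integral_complex_ofReal]
    congr 1; ext x
    rw [sqPos_apply, map_mul, mul_assoc, conj_mul_powS, Complex.conj_ofReal]
    push_cast; ring
  rw [h, Complex.ofReal_im]

-- The integral is the Fourier transform at the origin, where the multiplier ξ_j vanishes.
open FourierTransform in
lemma integral_D (j : Fin d) (f : 𝓢(Space d, ℂ)) : ∫ x, D j f x = 0 := by
  have h : 𝓕 (D j f) (0 : Space d) = ∫ x, D j f x := by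
    rw [fourier_coe, Real.fourier_eq]
    simp
  rw [← h, fourier_D]
  simp

lemma hasFDerivAt_norm_pow {E : Type*} [NormedAddCommGroup E] [NormedSpace ℝ E] (q : ℕ)
    {w : E → ℂ} {w' : E →L[ℝ] ℂ} {x : E} (hw : HasFDerivAt w w' x) :
    HasFDerivAt (fun y => ‖w y‖ ^ (2 * q + 2))
      ((2 * (q + 1 : ℝ) * ‖w x‖ ^ (2 * q)) • (innerSL ℝ (w x)).comp w') x := by
  have h := (hw.norm_sq).pow (q + 1)
  convert! h using 1
  · ext y; rw [← pow_mul]; ring_nf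
  · ext v
    simp [← pow_mul]
    ring

/-- The density |f|^(2q+2) is itself a Schwartz function `R`, and ∂_j R is (2q+2) times the
integrand's real part up to the factor x_j; integrate ∂_j(x_j R). -/
lemma re_ip_X_D_powS (q : ℕ) (j : Fin d) (f : 𝓢(Space d, ℂ)) :
    (ip (X j (D j f)) (powS q f)).re = -potential q f / (2 * q + 2) := by
  set R := mulS (conjS f) (powS q f) with hR
  have hRx : ∀ x, R x = ((‖f x‖ ^ (2 * q + 2) : ℝ) : ℂ) := fun x => conj_mul_powS q f x
  have hDR : ∀ x, D j R x =
      (((2 * q + 2) * ((starRingEnd ℂ) (D j f x) * powS q f x).re : ℝ) : ℂ) := by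
    intro x
    have h1 : HasFDerivAt (R : Space d → ℂ) _ x :=
      (Complex.ofRealCLM.hasFDerivAt.comp x
        (hasFDerivAt_norm_pow q (f.hasFDerivAt x))).congr_of_eventuallyEq
        (Filter.Eventually.of_forall hRx)
    rw [D_apply, partialDeriv, h1.fderiv, powS_apply, D_apply, partialDeriv]
    simp only [ContinuousLinearMap.coe_comp, Function.comp_apply, Complex.ofRealCLM_apply,
      smul_apply, innerSL_apply_apply, Complex.inner, smul_eq_mul]
    congr 1
    rw [mul_left_comm, Complex.re_ofReal_mul]
    simp
    ring
  have h0 := integral_D j (X j R)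
  rw [D_X, if_pos rfl] at h0
  have h1 : (∫ x, (X j (D j R) + R) x) = (∫ x, X j (D j R) x) + ∫ x, R x := by
    rw [← integral_add (X j (D j R)).integrable R.integrable]
    rfl
  have h2 : (∫ x, R x) = (potential q f : ℂ) := by
    rw [potential, ← integral_complex_ofReal]
    simp only [hRx]
  have h3 : (∫ x, X j (D j R) x) = (((2 * q + 2) * (ip (X j (D j f)) (powS q f)).re : ℝ) : ℂ) := by
    have : (ip (X j (D j f)) (powS q f)).re =
        ∫ x, ((starRingEnd ℂ) (X j (D j f) x) * powS q f x).re := by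
      rw [ip]
      exact (integral_re (integrable_conj_mul _ _)).symm
    rw [this, ← integral_const_mul, ← integral_complex_ofReal]
    congr 1; ext x
    rw [X_apply, hDR, X_apply, map_mul, Complex.conj_ofReal, mul_assoc, Complex.re_ofReal_mul]
    push_cast; ring
  rw [h1, h2, h3, ← Complex.ofReal_add, Complex.ofReal_eq_zero] at h0
  rw [eq_div_iff (by positivity)]
  linarith

lemma re_ip_euler_powS (q : ℕ) (f : 𝓢(Space d, ℂ)) :
    (ip (euler f) (powS q f)).re = -(d * potential q f) / (2 * q + 2) := by
  rw [euler_eq_sum, ip_sum_left, Complex.re_sum]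
  simp only [re_ip_X_D_powS]
  simp
  ring

/-- The coefficient comes from -2σ(d - 2d/(2q+2)): the constant term and the Euler term of `U_sqPos`
combined. The Laplacian term is left for integration by parts in σ. -/
lemma im_ip_U_sqPos (q : ℕ) (σ : ℝ) (f : 𝓢(Space d, ℂ)) :
    (ip (U σ (sqPos f)) (powS q (U σ f))).im =
      -(4 * σ * d * q / (2 * q + 2)) * potential q (U σ f)
        - 4 * σ ^ 2 * (ip (Lap (U σ f)) (powS q (U σ f))).im := by
  have hc : (-(4 * σ ^ 2) : ℂ) = ((-(4 * σ ^ 2) : ℝ) : ℂ) := by push_cast; ring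
  have hc2 : (2 * Complex.I * σ : ℂ) = ((2 * σ : ℝ) : ℂ) * Complex.I := by push_cast; ring
  have h2 : (2 : ℂ) = ((2 : ℝ) : ℂ) := by norm_num
  have hd : (d : ℂ) = ((d : ℝ) : ℂ) := by norm_num
  rw [U_sqPos, hc, hc2]
  simp only [ip_add_left, ip_smul_left, Complex.add_im, im_ip_sqPos_powS, ip_powS, map_mul,
    Complex.conj_I, Complex.conj_ofReal]
  rw [h2, hd, Complex.conj_ofReal, Complex.conj_ofReal]
  simp only [Complex.im_ofReal_mul, mul_assoc, neg_mul, Complex.neg_im, Complex.I_mul_im,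
    Complex.add_re, Complex.re_ofReal_mul, re_ip_euler_powS, Complex.ofReal_re]
  field_simp
  ring

lemma im_ip_U_dilation (q : ℕ) (σ : ℝ) (f : 𝓢(Space d, ℂ)) :
    (ip (U σ (dilation f)) (powS q (U σ f))).im =
      d * q / (2 * q + 2) * potential q (U σ f)
        + 2 * σ * (ip (Lap (U σ f)) (powS q (U σ f))).im := by
  have hc2 : (2 * Complex.I * σ : ℂ) = ((2 * σ : ℝ) : ℂ) * Complex.I := by push_cast; ring
  have hd : (d / 2 : ℂ) = ((d / 2 : ℝ) : ℂ) := by norm_num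
  rw [U_dilation, hc2, hd]
  simp only [ip_add_left, ip_smul_left, ip_powS, map_mul, map_neg,
    Complex.conj_I, Complex.conj_ofReal, neg_neg]
  simp only [Complex.I_mul_im, mul_assoc, neg_mul, Complex.neg_re, mul_neg, Complex.I_mul_re,
    Complex.add_re, Complex.re_ofReal_mul, re_ip_euler_powS, Complex.ofReal_re]
  field_simp
  ring

/-! ### Uniform decay -/

/-- An integrable weight dominating bounded families of Schwartz functions. -/
def weight (x : Space d) : ℝ :=
  (1 + ‖x‖) ^ (-((volume : Measure (Space d)).integrablePower : ℝ))

lemma integrable_weight : Integrable (weight : Space d → ℝ) :=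
  Measure.integrable_pow_neg_integrablePower _

lemma weight_pos (x : Space d) : 0 < weight x := by unfold weight; positivity

lemma weight_le_one (x : Space d) : weight x ≤ 1 :=
  Real.rpow_le_one_of_one_le_of_nonpos (by linarith [norm_nonneg x]) (by simp)

lemma BoundedFamily.le_weight {f : ι → 𝓢(Space d, ℂ)} (hf : BoundedFamily f) :
    ∃ C : ℝ, 0 ≤ C ∧ ∀ i x, ‖f i x‖ ≤ C * weight x := by
  obtain ⟨C, hC0, hC⟩ := hf.decay (volume : Measure (Space d)).integrablePower
  refine ⟨C, hC0, fun i x => ?_⟩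
  rw [weight, Real.rpow_neg (by positivity), Real.rpow_natCast, ← div_eq_mul_inv,
    le_div_iff₀ (by positivity), mul_comm]
  exact hC i x

lemma BoundedFamily.le_const {f : ι → 𝓢(Space d, ℂ)} (hf : BoundedFamily f) :
    ∃ C : ℝ, 0 ≤ C ∧ ∀ i x, ‖f i x‖ ≤ C := by
  obtain ⟨C, hC0, hC⟩ := hf.decay 0
  exact ⟨C, hC0, fun i x => by simpa using hC i x⟩

/-! ### Joint measurability -/

/-- Joint measurability in the parameter and x is what Fubini needs; ε = -1 and ε = 1 cover the
Fourier transform and its inverse. -/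
lemma stronglyMeasurable_integral_fourierChar {α : Type*} [MeasurableSpace α]
    {f : α → Space d → ℂ} (hf : StronglyMeasurable (Function.uncurry f)) (ε : ℝ) :
    StronglyMeasurable fun z : α × Space d =>
      ∫ v, ((Real.fourierChar (ε * inner ℝ v z.2) : Circle) : ℂ) * f z.1 v := by
  have hc : Continuous fun y : Space d × Space d =>
      ((Real.fourierChar (ε * inner ℝ y.2 y.1) : Circle) : ℂ) := by fun_prop
  have hm : Measurable fun z : (α × Space d) × Space d => z.1.2 :=
    measurable_snd.comp measurable_fst
  have h1 : StronglyMeasurable fun z : (α × Space d) × Space d =>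
      ((Real.fourierChar (ε * inner ℝ z.2 z.1.2) : Circle) : ℂ) :=
    (hc.measurable.comp (hm.prodMk measurable_snd)).stronglyMeasurable
  have h2 : StronglyMeasurable fun z : (α × Space d) × Space d => f z.1.1 z.2 :=
    hf.comp_measurable ((measurable_fst.comp measurable_fst).prodMk measurable_snd)
  exact (h1.mul h2).integral_prod_right'

lemma stronglyMeasurable_freePropagator {α : Type*} [MeasurableSpace α] {f : α → Space d → ℂ}
    (hf : StronglyMeasurable (Function.uncurry f)) {s : α → ℝ} (hs : Measurable s) :
    StronglyMeasurable (Function.uncurry fun a x => freePropagator (s a) (f a) x) := by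
  have h1 : StronglyMeasurable fun z : α × Space d => 𝓕 (f z.1) z.2 := by
    have := stronglyMeasurable_integral_fourierChar hf (-1)
    simpa only [Real.fourier_eq, neg_one_mul, Circle.smul_def, smul_eq_mul] using this
  have h2 : StronglyMeasurable
      (Function.uncurry fun a (ξ : Space d) => symbol (s a) ξ * 𝓕 (f a) ξ) := by
    have hc : Continuous fun y : ℝ × Space d => symbol y.1 y.2 := by
      unfold symbol; fun_prop
    have h3 : StronglyMeasurable fun z : α × Space d => symbol (s z.1) z.2 :=
      hc.stronglyMeasurable.comp_measurable ((hs.comp measurable_fst).prodMk measurable_snd)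
    exact h3.mul h1
  have h4 := stronglyMeasurable_integral_fourierChar h2 1
  have h5 : (Function.uncurry fun a x => freePropagator (s a) (f a) x) = fun z : α × Space d =>
      ∫ v, ((Real.fourierChar (1 * inner ℝ v z.2) : Circle) : ℂ) *
        (symbol (s z.1) v * 𝓕 (f z.1) v) := by
    ext z
    simp only [Function.uncurry, freePropagator, Real.fourierInv_eq, one_mul, Circle.smul_def,
      smul_eq_mul]
    rfl
  rw [h5]
  exact h4

lemma stronglyMeasurable_U {α : Type*} [MeasurableSpace α] {f : α → 𝓢(Space d, ℂ)}
    (hf : StronglyMeasurable (Function.uncurry fun a x => f a x)) {s : α → ℝ} (hs : Measurable s) :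
    StronglyMeasurable (Function.uncurry fun a x => U (s a) (f a) x) := by
  simp only [U_eq_freePropagator]
  exact stronglyMeasurable_freePropagator hf hs

lemma stronglyMeasurable_U_const (f : 𝓢(Space d, ℂ)) :
    StronglyMeasurable (Function.uncurry fun (σ : ℝ) x => U σ f x) :=
  stronglyMeasurable_U (f := fun _ => f)
    (f.continuous.stronglyMeasurable.comp_measurable measurable_snd) measurable_id

lemma stronglyMeasurable_powS {α : Type*} [MeasurableSpace α] {f : α → 𝓢(Space d, ℂ)}
    (hf : StronglyMeasurable (Function.uncurry fun a x => f a x)) (q : ℕ) :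
    StronglyMeasurable (Function.uncurry fun a x => powS q (f a) x) := by
  have : (Function.uncurry fun a x => powS q (f a) x) = fun z : α × Space d =>
      ((‖f z.1 z.2‖ ^ (2 * q) : ℝ) : ℂ) * f z.1 z.2 := by
    ext z; exact powS_apply q _ _
  rw [this]
  exact (Complex.continuous_ofReal.comp_stronglyMeasurable (hf.norm.pow _)).mul hf

/-- The integrand `e^{-iσΔ} [|e^{iσΔ} f|^(2q) e^{iσΔ} f]` of the nonlinearity. -/
def nlIntegrand (q : ℕ) (f : 𝓢(Space d, ℂ)) (σ : ℝ) : 𝓢(Space d, ℂ) := U (-σ) (powS q (U σ f))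

lemma stronglyMeasurable_nlIntegrand (q : ℕ) (f : 𝓢(Space d, ℂ)) :
    StronglyMeasurable (Function.uncurry fun (σ : ℝ) x => nlIntegrand q f σ x) :=
  stronglyMeasurable_U (stronglyMeasurable_powS (stronglyMeasurable_U_const f) q) measurable_neg

lemma nonlinearity_eq (q : ℕ) (f : 𝓢(Space d, ℂ)) (x : Space d) :
    nonlinearity (2 * q) f x = ∫ σ in (0 : ℝ)..1, nlIntegrand q f σ x := by
  rw [nonlinearity]
  congr 1
  ext σ
  rw [nlIntegrand, U_eq_freePropagator]
  congr 1
  ext y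
  rw [powS_apply, U_eq_freePropagator]

lemma stronglyMeasurable_nonlinearity (q : ℕ) (f : 𝓢(Space d, ℂ)) :
    StronglyMeasurable (nonlinearity (2 * q) f) := by
  have : nonlinearity (2 * q) (f : Space d → ℂ) =
      fun x => ∫ σ in Set.Ioc (0 : ℝ) 1, nlIntegrand q f σ x := by
    ext x; rw [nonlinearity_eq, intervalIntegral.integral_of_le zero_le_one]
  rw [this]
  exact (stronglyMeasurable_nlIntegrand q f).integral_prod_left'

lemma BoundedFamily.nlIntegrand {f : ι → 𝓢(Space d, ℂ)} (hf : BoundedFamily f) (q : ℕ) :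
    BoundedFamily fun i : ι × Set.Icc (0 : ℝ) 1 => nlIntegrand q (f i.1) i.2 := by
  refine BoundedFamily.U (R := 1) (fun i => ⟨by linarith [i.2.2.2], by linarith [i.2.2.1]⟩) ?_
  refine BoundedFamily.powS ?_ q
  exact BoundedFamily.U (R := 1) (fun i => ⟨by linarith [i.2.2.1], by linarith [i.2.2.2]⟩)
    (hf.comp Prod.fst)

lemma BoundedFamily.nonlinearity_le_weight {f : ι → 𝓢(Space d, ℂ)} (hf : BoundedFamily f) (q : ℕ) :
    ∃ C : ℝ, 0 ≤ C ∧ ∀ i x, ‖nonlinearity (2 * q) (f i) x‖ ≤ C * weight x := by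
  obtain ⟨C, hC0, hC⟩ := (hf.nlIntegrand q).le_weight
  refine ⟨C, hC0, fun i x => ?_⟩
  rw [nonlinearity_eq]
  have := intervalIntegral.norm_integral_le_of_norm_le_const (a := (0 : ℝ)) (b := 1)
    (f := fun σ => GabitovTuritsyn.nlIntegrand q (f i) σ x) (C := C * weight x) (fun σ hσ => ?_)
  · simpa using this
  · rw [Set.uIoc_of_le zero_le_one] at hσ
    exact hC (i, ⟨σ, hσ.1.le, hσ.2⟩) x

/-! ### Exchanging the integrals in `σ` and `x` -/

lemma integrable_prod_of_le_weight {G : ℝ → Space d → ℂ}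
    (hG : StronglyMeasurable (Function.uncurry G)) {C : ℝ}
    (hC : ∀ σ ∈ Set.Ioc (0 : ℝ) 1, ∀ x, ‖G σ x‖ ≤ C * weight x) :
    Integrable (Function.uncurry G) ((volume.restrict (Set.Ioc (0 : ℝ) 1)).prod volume) := by
  have hb : Integrable (fun z : ℝ × Space d => C * weight z.2)
      ((volume.restrict (Set.Ioc (0 : ℝ) 1)).prod volume) :=
    (integrable_weight.comp_snd _).const_mul C
  refine hb.mono' hG.aestronglyMeasurable ?_
  have : (volume.restrict (Set.Ioc (0 : ℝ) 1)).prod (volume : Measure (Space d)) =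
      (volume.prod volume).restrict (Set.Ioc (0 : ℝ) 1 ×ˢ Set.univ) := by
    rw [← Measure.prod_restrict, Measure.restrict_univ]
  rw [this]
  filter_upwards [ae_restrict_mem (measurableSet_Ioc.prod MeasurableSet.univ)] with z hz
  exact hC z.1 hz.1 z.2

/-- Fubini: for σ in [0, 1] the integrands form a bounded Schwartz family, so one integrable weight
in x dominates all of them. -/
lemma integral_mul_nonlinearity {k : Space d → ℂ} (hk : StronglyMeasurable k) {B : ℝ}
    (hB : ∀ x, ‖k x‖ ≤ B) (q : ℕ) (f : 𝓢(Space d, ℂ)) :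
    IntervalIntegrable (fun σ => ∫ x, k x * nlIntegrand q f σ x) volume 0 1 ∧
    ∫ x, k x * nonlinearity (2 * q) f x =
      ∫ σ in (0 : ℝ)..1, ∫ x, k x * nlIntegrand q f σ x := by
  obtain ⟨C, hC0, hC⟩ := ((boundedFamily_const (ι := Unit) f).nlIntegrand q).le_weight
  have hB0 : 0 ≤ B := (norm_nonneg _).trans (hB 0)
  have hInt := integrable_prod_of_le_weight (G := fun σ x => k x * nlIntegrand q f σ x)
    (C := B * C) ((hk.comp_measurable measurable_snd).mul (stronglyMeasurable_nlIntegrand q f))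
    (fun σ hσ x => by
      rw [norm_mul, mul_assoc]
      have := hC ((), ⟨σ, hσ.1.le, hσ.2⟩) x
      gcongr
      exact hB x)
  refine ⟨?_, ?_⟩
  · rw [intervalIntegrable_iff_integrableOn_Ioc_of_le zero_le_one]
    exact hInt.integral_prod_left
  · simp only [intervalIntegral.integral_of_le zero_le_one]
    rw [integral_integral_swap hInt]
    congr 1; ext x
    rw [nonlinearity_eq, intervalIntegral.integral_of_le zero_le_one, integral_const_mul]

lemma ip_nonlinearity (q : ℕ) (g f : 𝓢(Space d, ℂ)) :
    IntervalIntegrable (fun σ => ip (U σ g) (powS q (U σ f))) volume 0 1 ∧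
    ∫ x, (starRingEnd ℂ) (g x) * nonlinearity (2 * q) f x =
      ∫ σ in (0 : ℝ)..1, ip (U σ g) (powS q (U σ f)) := by
  obtain ⟨B, -, hB⟩ := (boundedFamily_const (ι := Unit) (conjS g)).le_const
  have := integral_mul_nonlinearity (conjS g).continuous.stronglyMeasurable (hB ()) q f
  simp only [ip_U]
  exact this

lemma integral_potential_swap (q : ℕ) (f : 𝓢(Space d, ℂ)) :
    ∫ x, ∫ σ in (0 : ℝ)..1, ‖freePropagator σ f x‖ ^ (2 * q + 2) =
      ∫ σ in (0 : ℝ)..1, potential q (U σ f) := by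
  have hb : BoundedFamily fun σ : Set.Icc (0 : ℝ) 1 => U (σ : ℝ) f :=
    BoundedFamily.U (R := 1) (fun i => ⟨by linarith [i.2.1], i.2.2⟩) (boundedFamily_const f)
  obtain ⟨C, hC0, hC⟩ := ((hb.clm conjS).mulS (hb.powS q)).le_weight
  have hInt := integrable_prod_of_le_weight
    (G := fun σ x => ((‖U σ f x‖ ^ (2 * q + 2) : ℝ) : ℂ)) (C := C)
    (Complex.continuous_ofReal.comp_stronglyMeasurable ((stronglyMeasurable_U_const f).norm.pow _))
    (fun σ hσ x => by
      have := hC ⟨σ, hσ.1.le, hσ.2⟩ x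
      rwa [mulS_apply, conjS_apply, conj_mul_powS] at this)
  have hInt' := hInt.re
  simp only [Function.uncurry_def, RCLike.re_eq_complex_re, Complex.ofReal_re] at hInt'
  simp only [intervalIntegral.integral_of_le zero_le_one, potential, ← U_eq_freePropagator]
  exact (integral_integral_swap hInt').symm

/-! ### The flow of the free propagator -/

open FourierTransform in
lemma fourier_Lap (f : 𝓢(Space d, ℂ)) (ξ : Space d) :
    𝓕 (Lap f) ξ = -(((2 * Real.pi * ‖ξ‖) ^ 2 : ℝ) : ℂ) * 𝓕 f ξ := by
  have h2 : 𝓕 (Lap f) = ∑ j, 𝓕 (D j (D j f)) := by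
    rw [Lap_eq_sum]
    exact map_sum (fourierCLM ℂ 𝓢(Space d, ℂ)) _ _
  have h3 : 𝓕 (Lap f) = ((2 * Real.pi * Complex.I) ^ 2 : ℂ) • sqPos (𝓕 f) := by
    rw [h2, sqPos_eq_sum, Finset.smul_sum]
    refine Finset.sum_congr rfl fun j _ => ?_
    rw [fourier_D, fourier_D, map_smul, smul_smul, sq]
  rw [h3, smul_apply, sqPos_apply, smul_eq_mul, mul_pow _ Complex.I, Complex.I_sq]
  push_cast
  ring

lemma hasDerivAt_symbol (σ : ℝ) (ξ : Space d) :
    HasDerivAt (fun σ : ℝ => symbol σ ξ)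
      (Complex.I * (-(((2 * Real.pi * ‖ξ‖) ^ 2 : ℝ) : ℂ) * symbol σ ξ)) σ := by
  have h1 : HasDerivAt (fun σ : ℝ => ((σ * (2 * Real.pi * ‖ξ‖) ^ 2 : ℝ) : ℂ))
      (((1 * (2 * Real.pi * ‖ξ‖) ^ 2 : ℝ) : ℂ)) σ :=
    ((hasDerivAt_id σ).mul_const _).ofReal_comp
  have h2 := (h1.const_mul (-Complex.I)).cexp
  convert! h2 using 1
  simp only [symbol, one_mul]
  ring

open FourierTransform in
lemma hasDerivAt_U (f : 𝓢(Space d, ℂ)) (σ : ℝ) (x : Space d) :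
    HasDerivAt (fun σ => U σ f x) (Complex.I * Lap (U σ f) x) σ := by
  have hU : ∀ (g : 𝓢(Space d, ℂ)) (τ : ℝ), U τ g x =
      ∫ ξ, Real.fourierChar (inner ℝ ξ x) • (symbol τ ξ * 𝓕 g ξ) := by
    intro g τ
    rw [U_eq_freePropagator, freePropagator, Real.fourierInv_eq]
    rfl
  have hInt : ∀ (g : 𝓢(Space d, ℂ)) (τ : ℝ),
      Integrable fun ξ => Real.fourierChar (inner ℝ ξ x) • (symbol τ ξ * 𝓕 g ξ) := by
    intro g τ
    refine (𝓕 g).integrable.norm.mono' ?_ (Filter.Eventually.of_forall fun ξ => ?_)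
    · have : Continuous fun ξ : Space d => Real.fourierChar (inner ℝ ξ x) := by
        fun_prop
      exact (this.smul ((contDiff_symbol τ).continuous.mul (𝓕 g).continuous)).aestronglyMeasurable
    · rw [Circle.norm_smul, norm_mul, norm_symbol, one_mul]
  rw [← U_Lap, hU, ← integral_const_mul]
  simp only [hU f]
  refine (hasDerivAt_integral_of_dominated_loc_of_deriv_le
    (bound := fun ξ => ‖𝓕 (Lap f) ξ‖) Filter.univ_mem
    (Filter.Eventually.of_forall fun τ => (hInt f τ).aestronglyMeasurable) (hInt f σ)
    ((hInt (Lap f) σ).const_mul _).aestronglyMeasurable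
    (F' := fun τ ξ => Complex.I * Real.fourierChar (inner ℝ ξ x) • (symbol τ ξ * 𝓕 (Lap f) ξ))
    ?_ (𝓕 (Lap f)).integrable.norm ?_).2
  · refine Filter.Eventually.of_forall fun ξ τ _ => ?_
    rw [norm_mul, Complex.norm_I, one_mul, Circle.norm_smul, norm_mul, norm_symbol, one_mul]
  · refine Filter.Eventually.of_forall fun ξ τ _ => ?_
    have h := ((hasDerivAt_symbol τ ξ).mul_const (𝓕 f ξ)).const_mul
      ((Real.fourierChar (inner ℝ ξ x) : Circle) : ℂ)
    simp only [Circle.smul_def, smul_eq_mul]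
    convert! h using 1
    rw [fourier_Lap]
    ring

/-- Since ∂_σ w = iΔw, the derivative of |w|^(2q+2) is (2q+2) Re(conj(iΔw) |w|^(2q) w), which is the
imaginary part shown. This makes the Laplacian terms of the virial computation exact σ-derivatives.
-/
lemma hasDerivAt_potential_U (q : ℕ) (f : 𝓢(Space d, ℂ)) (σ : ℝ) :
    HasDerivAt (fun σ => potential q (U σ f))
      ((2 * q + 2) * (ip (Lap (U σ f)) (powS q (U σ f))).im) σ := by
  set R := |σ| + 1 with hR
  have hb : BoundedFamily fun τ : Set.Icc (-R) R => U (τ : ℝ) f :=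
    BoundedFamily.U (R := R) (fun i => i.2) (boundedFamily_const f)
  obtain ⟨C, hC0, hC⟩ := (((hb.clmComplex Lap).clm conjS).mulS (hb.powS q)).le_weight
  have hmem : Set.Icc (-R) R ∈ nhds σ := by
    apply Icc_mem_nhds
    · have := neg_abs_le σ; linarith
    · have := le_abs_self σ; linarith
  have him : (ip (Lap (U σ f)) (powS q (U σ f))).im =
      ∫ x, ((starRingEnd ℂ) (Lap (U σ f) x) * powS q (U σ f) x).im :=
    (integral_im (integrable_conj_mul _ _)).symm
  rw [him, ← integral_const_mul]
  refine (hasDerivAt_integral_of_dominated_loc_of_deriv_le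
    (bound := fun x => (2 * q + 2) * (C * weight x)) hmem
    (F' := fun τ x => (2 * q + 2) * ((starRingEnd ℂ) (Lap (U τ f) x) * powS q (U τ f) x).im)
    (Filter.Eventually.of_forall fun τ => (integrable_potential q _).aestronglyMeasurable)
    (integrable_potential q _) ?_ ?_ ((integrable_weight.const_mul C).const_mul _) ?_).2
  · exact ((integrable_conj_mul _ _).im.const_mul _).aestronglyMeasurable
  · refine Filter.Eventually.of_forall fun x τ hτ => ?_
    rw [norm_mul, Real.norm_of_nonneg (by positivity : (0 : ℝ) ≤ 2 * q + 2)]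
    gcongr
    exact (Complex.abs_im_le_norm _).trans (hC ⟨τ, hτ⟩ x)
  · refine Filter.Eventually.of_forall fun x τ _ => ?_
    have h := (hasFDerivAt_norm_pow q (hasDerivAt_U f τ x).hasFDerivAt).hasDerivAt
    convert! h using 1
    rw [powS_apply, mul_left_comm, Complex.im_ofReal_mul]
    simp [Complex.inner]
    ring

/-! ### Differentiating functionals along a solution -/

/-- The right-hand side of the equation `u_t = i (γ Δu + …)`. -/
def velocity (q : ℕ) (γ : ℝ) (f : 𝓢(Space d, ℂ)) (x : Space d) : ℂ :=
  Complex.I * ((γ : ℂ) * Lap f x + nonlinearity (2 * q) f x)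

lemma BoundedFamily.velocity_le_weight {f : ι → 𝓢(Space d, ℂ)} (hf : BoundedFamily f) (q : ℕ)
    (γ : ℝ) : ∃ C : ℝ, 0 ≤ C ∧ ∀ i x, ‖velocity q γ (f i) x‖ ≤ C * weight x := by
  obtain ⟨C₁, h₁, hC₁⟩ := (hf.clmComplex Lap).le_weight
  obtain ⟨C₂, h₂, hC₂⟩ := hf.nonlinearity_le_weight q
  refine ⟨|γ| * C₁ + C₂, by positivity, fun i x => ?_⟩
  rw [velocity, norm_mul, Complex.norm_I, one_mul, add_mul, mul_assoc]
  refine (norm_add_le _ _).trans (add_le_add ?_ (hC₂ i x))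
  rw [norm_mul, Complex.norm_real, Real.norm_eq_abs]
  gcongr
  exact hC₁ i x

lemma IsSolution.hasDerivAt {q : ℕ} {γ : ℝ} {u₀ : 𝓢(Space d, ℂ)} {I : Set ℝ}
    {u : ℝ → 𝓢(Space d, ℂ)} (hu : IsSolution (2 * q) γ u₀ I u) {t : ℝ} (ht : t ∈ I)
    (x : Space d) : HasDerivAt (fun s => u s x) (velocity q γ (u t) x) t := by
  have := hu.equation t ht x
  rwa [← Lap_apply] at this

/-- On a compact time interval the velocity is dominated by a multiple of `weight`; the mean value
inequality at each x makes the solution Lipschitz in time with that weight. -/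
lemma IsSolution.exists_nhds {q : ℕ} {γ : ℝ} {u₀ : 𝓢(Space d, ℂ)} {I : Set ℝ}
    {u : ℝ → 𝓢(Space d, ℂ)} (hu : IsSolution (2 * q) γ u₀ I u) {s : ℝ} (hs : s ∈ I) :
    ∃ K ∈ nhds s, s ∈ K ∧ BoundedFamily (fun t : K => u t) ∧ ∃ C : ℝ, 0 ≤ C ∧
      ∀ t ∈ K, ∀ x, ‖u t x - u s x‖ ≤ C * weight x * |t - s| := by
  obtain ⟨ε, hε, hball⟩ := Metric.isOpen_iff.1 hu.isOpen s hs
  have hK : Set.Icc (s - ε / 2) (s + ε / 2) ⊆ I := by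
    rw [← Real.closedBall_eq_Icc]
    exact (Metric.closedBall_subset_ball (by linarith)).trans hball
  have hb := boundedFamily_of_isCompact isCompact_Icc (hu.continuousOn.mono hK)
  obtain ⟨C, hC0, hC⟩ := hb.velocity_le_weight q γ
  have hsK : s ∈ Set.Icc (s - ε / 2) (s + ε / 2) := ⟨by linarith, by linarith⟩
  refine ⟨_, Icc_mem_nhds (by linarith) (by linarith), hsK, hb, C, hC0, fun t ht x => ?_⟩
  have := (convex_Icc (s - ε / 2) (s + ε / 2)).norm_image_sub_le_of_norm_hasDerivWithin_le
    (f := fun t => u t x) (fun r hr => (hu.hasDerivAt (hK hr) x).hasDerivWithinAt)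
    (fun r hr => hC ⟨r, hr⟩ x) hsK ht
  simpa using this

/-- Dominated convergence for difference quotients. The test function may depend on t, which the
quadratic functionals require. -/
lemma IsSolution.tendsto_pairing {q : ℕ} {γ : ℝ} {u₀ : 𝓢(Space d, ℂ)} {I : Set ℝ}
    {u : ℝ → 𝓢(Space d, ℂ)} (hu : IsSolution (2 * q) γ u₀ I u) {s : ℝ} (hs : s ∈ I)
    {g : ℝ → Space d → ℂ} (hg : ∀ t, AEStronglyMeasurable (g t)) {B : ℝ}
    (hB : ∀ᶠ t in nhds s, ∀ x, ‖g t x‖ ≤ B)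
    (hgc : ∀ x, Filter.Tendsto (fun t => g t x) (nhds s) (nhds (g s x))) :
    Filter.Tendsto (fun t => (t - s)⁻¹ * (∫ x, g t x * (u t x - u s x)).re)
      (nhdsWithin s {s}ᶜ) (nhds (∫ x, g s x * velocity q γ (u s) x).re) := by
  obtain ⟨K, hK, -, -, C, hC0, hC⟩ := hu.exists_nhds hs
  have h : Filter.Tendsto (fun t => ∫ x, g t x * (((t - s)⁻¹ : ℝ) • (u t x - u s x)))
      (nhdsWithin s {s}ᶜ) (nhds (∫ x, g s x * velocity q γ (u s) x)) := by
    refine tendsto_integral_filter_of_dominated_convergence (fun x => B * (C * weight x))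
      (Filter.Eventually.of_forall fun t => ?_) ?_ ((integrable_weight.const_mul C).const_mul B)
      (Filter.Eventually.of_forall fun x => ?_)
    · exact (hg t).mul (((u t).continuous.sub (u s).continuous).const_smul
        ((t - s)⁻¹ : ℝ)).aestronglyMeasurable
    · filter_upwards [nhdsWithin_le_nhds hB, nhdsWithin_le_nhds hK, self_mem_nhdsWithin]
        with t htB htK hts
      refine Filter.Eventually.of_forall fun x => ?_
      have hts' : 0 < |t - s| := abs_pos.2 (sub_ne_zero.2 hts)
      have hB0 : 0 ≤ B := (norm_nonneg _).trans (htB x)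
      rw [norm_mul, norm_smul, norm_inv, Real.norm_eq_abs]
      refine mul_le_mul (htB x) ?_ (by positivity) hB0
      rw [inv_mul_le_iff₀ hts', mul_comm]
      exact hC t htK x
    · refine ((hgc x).mono_left nhdsWithin_le_nhds).mul ?_
      exact (hasDerivAt_iff_tendsto_slope.1 (hu.hasDerivAt hs x))
  have h2 := (Complex.continuous_re.tendsto _).comp h
  refine h2.congr fun t => ?_
  simp only [Function.comp_apply, mul_smul_comm, integral_smul, Complex.smul_re, smul_eq_mul]

lemma integrable_mul_nonlinearity {k : Space d → ℂ} (hk : StronglyMeasurable k) {B : ℝ}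
    (hB : ∀ x, ‖k x‖ ≤ B) (q : ℕ) (f : 𝓢(Space d, ℂ)) :
    Integrable fun x => k x * nonlinearity (2 * q) f x := by
  obtain ⟨C, hC0, hC⟩ := (boundedFamily_const (ι := Unit) f).nonlinearity_le_weight q
  refine ((integrable_weight.const_mul C).const_mul B).mono'
    (hk.mul (stronglyMeasurable_nonlinearity q f)).aestronglyMeasurable
    (Filter.Eventually.of_forall fun x => ?_)
  rw [norm_mul]
  exact mul_le_mul (hB x) (hC () x) (norm_nonneg _) ((norm_nonneg _).trans (hB x))

/-- The imaginary part of the pairing of `g` with the nonlinear term. -/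
def nlPairing (q : ℕ) (g f : 𝓢(Space d, ℂ)) : ℝ :=
  ∫ σ in (0 : ℝ)..1, (ip (U σ g) (powS q (U σ f))).im

lemma im_integral_nonlinearity (q : ℕ) (g f : 𝓢(Space d, ℂ)) :
    (∫ x, (starRingEnd ℂ) (g x) * nonlinearity (2 * q) f x).im = nlPairing q g f := by
  obtain ⟨h1, h2⟩ := ip_nonlinearity q g f
  rw [h2, nlPairing]
  exact (Complex.imCLM.intervalIntegral_comp_comm h1).symm

lemma re_integral_velocity (q : ℕ) (γ : ℝ) (g f : 𝓢(Space d, ℂ)) :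
    (∫ x, (starRingEnd ℂ) (g x) * velocity q γ f x).re =
      -(γ * (ip g (Lap f)).im + nlPairing q g f) := by
  obtain ⟨B, -, hB⟩ := (boundedFamily_const (ι := Unit) (conjS g)).le_const
  have hInt : Integrable fun x => (starRingEnd ℂ) (g x) * nonlinearity (2 * q) f x :=
    integrable_mul_nonlinearity (conjS g).continuous.stronglyMeasurable (hB ()) q f
  have h : ∫ x, (starRingEnd ℂ) (g x) * velocity q γ f x =
      Complex.I * (γ * ip g (Lap f) + ∫ x, (starRingEnd ℂ) (g x) * nonlinearity (2 * q) f x) := by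
    rw [ip, ← integral_const_mul, ← integral_add ((integrable_conj_mul g (Lap f)).const_mul _) hInt,
      ← integral_const_mul]
    congr 1; ext x
    rw [velocity]
    ring
  rw [h, Complex.I_mul_re, Complex.add_im, Complex.im_ofReal_mul, im_integral_nonlinearity]

/-- For symmetric A the increment factors as Re⟨A(u(t) + u(s)), u(t) - u(s)⟩, so a weak difference
quotient of u suffices and no derivative in the Schwartz topology is needed. -/
lemma IsSolution.hasDerivAt_quadratic {q : ℕ} {γ : ℝ} {u₀ : 𝓢(Space d, ℂ)} {I : Set ℝ}
    {u : ℝ → 𝓢(Space d, ℂ)} (hu : IsSolution (2 * q) γ u₀ I u) {s : ℝ} (hs : s ∈ I)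
    (A : 𝓢(Space d, ℂ) →L[ℂ] 𝓢(Space d, ℂ)) (hA : ∀ f g, ip (A f) g = ip f (A g)) :
    HasDerivAt (fun t => (ip (u t) (A (u t))).re)
      (-2 * (γ * (ip (A (u s)) (Lap (u s))).im + nlPairing q (A (u s)) (u s))) s := by
  obtain ⟨K, hK, hsK, hb, -⟩ := hu.exists_nhds hs
  have hcont : ContinuousAt u s := hu.continuousOn.continuousAt (hu.isOpen.mem_nhds hs)
  rw [hasDerivAt_iff_tendsto_slope]
  obtain ⟨B, hB0, hB⟩ := (hb.clmComplex A).le_const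
  have key := hu.tendsto_pairing hs (g := fun t x => (starRingEnd ℂ) (A (u t + u s) x))
    (B := B + B)
    (fun t => (conjS (A (u t + u s))).continuous.aestronglyMeasurable) ?_ ?_
  · have hlim : (∫ x, (starRingEnd ℂ) (A (u s + u s) x) * velocity q γ (u s) x).re =
        -2 * (γ * (ip (A (u s)) (Lap (u s))).im + nlPairing q (A (u s)) (u s)) := by
      have h2 : A (u s + u s) = (2 : ℂ) • A (u s) := by rw [map_add, two_smul]
      have h3 : ∫ x, (starRingEnd ℂ) (A (u s + u s) x) * velocity q γ (u s) x =
          ((2 : ℝ) : ℂ) * ∫ x, (starRingEnd ℂ) (A (u s) x) * velocity q γ (u s) x := by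
        rw [← integral_const_mul, h2]
        congr 1; ext x
        simp only [smul_apply, smul_eq_mul, map_mul, map_ofNat, Complex.ofReal_ofNat, mul_assoc]
      rw [h3, Complex.re_ofReal_mul, re_integral_velocity]
      ring
    rw [hlim] at key
    refine key.congr fun t => ?_
    rw [slope_def_field, div_eq_inv_mul]
    congr 1
    have h4 : (∫ x, (starRingEnd ℂ) (A (u t + u s) x) * (u t x - u s x)) =
        ip (A (u t + u s)) (u t - u s) := rfl
    have hsub : u t - u s = u t + (-1 : ℂ) • u s := by simp [sub_eq_add_neg]
    rw [h4, hsub, map_add]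
    simp only [ip_add_left, ip_add_right, ip_smul_right, hA, Complex.add_re, neg_mul, one_mul,
      Complex.neg_re]
    have h5 : (ip (u t) (A (u s))).re = (ip (u s) (A (u t))).re := by
      rw [ip_re_comm, hA]
    linarith
  · filter_upwards [hK] with t ht x
    rw [RCLike.norm_conj, map_add]
    exact (norm_add_le _ _).trans (add_le_add (hB ⟨t, ht⟩ x) (hB ⟨s, hsK⟩ x))
  · intro x
    have h1 : ContinuousAt (fun t => A (u t + u s)) s :=
      A.continuous.continuousAt.comp (hcont.add continuousAt_const)
    have h2 : Continuous fun f : 𝓢(Space d, ℂ) => f x :=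
      (BoundedContinuousFunction.evalCLM ℂ x).continuous.comp
        (toBoundedContinuousFunctionCLM ℂ (Space d) ℂ).continuous
    exact (Complex.continuous_conj.comp h2).continuousAt.comp h1

/-! ### The potential energy along a solution -/

lemma exists_pow_remainder_le (R : ℝ) (m : ℕ) : ∃ M : ℝ, 0 ≤ M ∧
    ∀ X ∈ Set.Icc 0 R, ∀ Y ∈ Set.Icc 0 R,
      |X ^ (m + 1) - Y ^ (m + 1) - (m + 1) * Y ^ m * (X - Y)| ≤ M * (X - Y) ^ 2 := by
  rcases lt_or_ge R 0 with hR | hR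
  · exact ⟨0, le_rfl, fun X hX => absurd (hX.1.trans hX.2) (not_le.2 hR)⟩
  induction m with
  | zero => exact ⟨0, le_rfl, fun X _ Y _ => by simp⟩
  | succ m ih =>
    obtain ⟨M, hM, h⟩ := ih
    -- The new remainder is X times the old one plus (m + 1) Y^m (X - Y)², whence this recursion for
    -- the constant.
    refine ⟨R * M + (m + 1) * R ^ m, by positivity, fun X hX Y hY => ?_⟩
    have : X ^ (m + 1 + 1) - Y ^ (m + 1 + 1) - ((m + 1 : ℕ) + 1) * Y ^ (m + 1) * (X - Y) =
        X * (X ^ (m + 1) - Y ^ (m + 1) - (m + 1) * Y ^ m * (X - Y))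
          + (m + 1) * Y ^ m * (X - Y) ^ 2 := by
      push_cast; ring
    rw [this]
    refine (abs_add_le _ _).trans ?_
    rw [add_mul (R * M), abs_mul, abs_of_nonneg hX.1,
      abs_of_nonneg (a := (m + 1) * Y ^ m * (X - Y) ^ 2)
      (by have := hY.1; positivity)]
    have h1 := h X hX Y hY
    have h2 := hX.2
    have h3 := hY.2
    have h4 := hY.1
    have h5 := hX.1
    rw [mul_assoc R]
    gcongr

/-- Apply the scalar remainder to ‖a‖² and ‖b‖², whose difference is at most 2R‖a - b‖ in size; the
second-order part of ‖a‖² - ‖b‖² itself adds the other term of the constant. -/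
lemma exists_norm_pow_remainder_le (R : ℝ) (q : ℕ) : ∃ M : ℝ, 0 ≤ M ∧
    ∀ a b : ℂ, ‖a‖ ≤ R → ‖b‖ ≤ R →
      |‖a‖ ^ (2 * q + 2) - ‖b‖ ^ (2 * q + 2) -
        (2 * q + 2) * ((starRingEnd ℂ) (((‖b‖ ^ (2 * q) : ℝ) : ℂ) * b) * (a - b)).re|
        ≤ M * ‖a - b‖ ^ 2 := by
  obtain ⟨M, hM, h⟩ := exists_pow_remainder_le (R ^ 2) q
  rcases lt_or_ge R 0 with hR | hR
  · exact ⟨0, le_rfl, fun a _ ha => absurd ((norm_nonneg a).trans ha) (not_le.2 hR)⟩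
  refine ⟨M * (2 * R) ^ 2 + (q + 1) * R ^ (2 * q), by positivity, fun a b ha hb => ?_⟩
  have h1 := h (‖a‖ ^ 2) ⟨by positivity, by gcongr⟩ (‖b‖ ^ 2) ⟨by positivity, by gcongr⟩
  have h2 : ‖a‖ ^ 2 - ‖b‖ ^ 2 = 2 * ((starRingEnd ℂ) b * (a - b)).re + ‖a - b‖ ^ 2 := by
    simp only [← Complex.normSq_eq_norm_sq, Complex.normSq_apply]
    simp
    ring
  have h3 : ((starRingEnd ℂ) (((‖b‖ ^ (2 * q) : ℝ) : ℂ) * b) * (a - b)).re =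
      ‖b‖ ^ (2 * q) * ((starRingEnd ℂ) b * (a - b)).re := by
    rw [map_mul, Complex.conj_ofReal, mul_assoc, Complex.re_ofReal_mul]
  have h4 : (‖a‖ ^ 2 - ‖b‖ ^ 2) ^ 2 ≤ (2 * R) ^ 2 * ‖a - b‖ ^ 2 := by
    have : ‖a‖ ^ 2 - ‖b‖ ^ 2 = (‖a‖ + ‖b‖) * (‖a‖ - ‖b‖) := by ring
    rw [this, mul_pow]
    gcongr ?_ * ?_
    · gcongr; linarith
    · exact sq_le_sq' (by linarith [norm_sub_norm_le b a, norm_sub_rev a b])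
        (norm_sub_norm_le a b)
  have h5 : ‖a‖ ^ (2 * q + 2) - ‖b‖ ^ (2 * q + 2) -
      (2 * q + 2) * (‖b‖ ^ (2 * q) * ((starRingEnd ℂ) b * (a - b)).re) =
      ((‖a‖ ^ 2) ^ (q + 1) - (‖b‖ ^ 2) ^ (q + 1) -
        (q + 1) * (‖b‖ ^ 2) ^ q * (‖a‖ ^ 2 - ‖b‖ ^ 2)) +
      (q + 1) * ‖b‖ ^ (2 * q) * ‖a - b‖ ^ 2 := by
    have h6 : ((starRingEnd ℂ) b * (a - b)).re = (‖a‖ ^ 2 - ‖b‖ ^ 2 - ‖a - b‖ ^ 2) / 2 := by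
      linarith
    rw [h6, ← pow_mul, ← pow_mul, ← pow_mul]
    ring
  rw [h3, h5]
  refine (abs_add_le _ _).trans ?_
  rw [add_mul (M * (2 * R) ^ 2),
    abs_of_nonneg (a := (q + 1) * ‖b‖ ^ (2 * q) * ‖a - b‖ ^ 2) (by positivity)]
  refine add_le_add (h1.trans ?_) (by gcongr)
  rw [mul_assoc]
  gcongr

lemma re_ip_self (f : 𝓢(Space d, ℂ)) : (ip f f).re = ∫ x, ‖f x‖ ^ 2 := by
  rw [ip, ← RCLike.re_eq_complex_re, ← integral_re (integrable_conj_mul f f)]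
  congr 1; ext x
  rw [Complex.conj_mul']
  simp [← Complex.ofReal_pow]

lemma integrable_norm_sq (f : 𝓢(Space d, ℂ)) : Integrable fun x => ‖f x‖ ^ 2 := by
  simpa using integrable_potential 0 f

lemma abs_potential_remainder_le {q : ℕ} {R M : ℝ} (hM : ∀ a b : ℂ, ‖a‖ ≤ R → ‖b‖ ≤ R →
      |‖a‖ ^ (2 * q + 2) - ‖b‖ ^ (2 * q + 2) -
        (2 * q + 2) * ((starRingEnd ℂ) (((‖b‖ ^ (2 * q) : ℝ) : ℂ) * b) * (a - b)).re|
        ≤ M * ‖a - b‖ ^ 2) {f g : 𝓢(Space d, ℂ)} (hf : ∀ x, ‖f x‖ ≤ R) (hg : ∀ x, ‖g x‖ ≤ R) :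
    |potential q f - potential q g - (2 * q + 2) * (ip (powS q g) (f - g)).re| ≤
      M * (ip (f - g) (f - g)).re := by
  have hi := integrable_conj_mul (powS q g) (f - g)
  have hre : Integrable fun x => ((starRingEnd ℂ) (powS q g x) * (f - g) x).re := hi.re
  have hsub : Integrable fun x => ‖f x‖ ^ (2 * q + 2) - ‖g x‖ ^ (2 * q + 2) :=
    (integrable_potential q f).sub (integrable_potential q g)
  have h1 : (ip (powS q g) (f - g)).re =
      ∫ x, ((starRingEnd ℂ) (powS q g x) * (f - g) x).re := (integral_re hi).symm
  rw [h1, potential, potential, re_ip_self, ← integral_const_mul, ← integral_const_mul,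
    ← integral_sub (integrable_potential q f) (integrable_potential q g),
    ← integral_sub hsub (hre.const_mul _)]
  refine (abs_integral_le_integral_abs).trans (integral_mono ?_ ?_ fun x => ?_)
  · exact (hsub.sub (hre.const_mul _)).abs
  · exact (integrable_norm_sq _).const_mul _
  · simp only [powS_apply, sub_apply]
    exact hM _ _ (hf x) (hg x)

/-- The potential energy `∫₀¹ ∫ |e^{iσΔ} f|^(2q+2) dx dσ`. -/
def avgPotential (q : ℕ) (f : 𝓢(Space d, ℂ)) : ℝ := ∫ σ in (0 : ℝ)..1, potential q (U σ f)

lemma continuous_potential_U (q : ℕ) (f : 𝓢(Space d, ℂ)) :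
    Continuous fun σ => potential q (U σ f) :=
  continuous_iff_continuousAt.2 fun σ => (hasDerivAt_potential_U q f σ).continuousAt

lemma re_integral_conj_nonlinearity (q : ℕ) (g f : 𝓢(Space d, ℂ)) :
    IntervalIntegrable (fun σ => (ip (powS q (U σ f)) (U σ g)).re) volume 0 1 ∧
    (∫ x, (starRingEnd ℂ) (nonlinearity (2 * q) f x) * g x).re =
      ∫ σ in (0 : ℝ)..1, (ip (powS q (U σ f)) (U σ g)).re := by
  obtain ⟨h1, h2⟩ := ip_nonlinearity q g f
  have h3 : ∀ σ, (ip (powS q (U σ f)) (U σ g)).re = (ip (U σ g) (powS q (U σ f))).re :=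
    fun σ => ip_re_comm _ _
  have h4 : ∫ x, (starRingEnd ℂ) (nonlinearity (2 * q) f x) * g x =
      (starRingEnd ℂ) (∫ x, (starRingEnd ℂ) (g x) * nonlinearity (2 * q) f x) := by
    rw [← integral_conj]
    congr 1; ext x; simp; ring
  simp only [h3]
  refine ⟨⟨h1.1.re, h1.2.re⟩, ?_⟩
  rw [h4, Complex.conj_re, h2]
  exact (Complex.reCLM.intervalIntegral_comp_comm h1).symm

/-- By unitarity ‖e^{iσΔ}(f - g)‖₂ does not depend on σ, so the quadratic remainder survives
averaging, and the linear term is the pairing with the nonlinearity. -/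
lemma abs_avgPotential_remainder_le {q : ℕ} {R M : ℝ} (hM : ∀ a b : ℂ, ‖a‖ ≤ R → ‖b‖ ≤ R →
      |‖a‖ ^ (2 * q + 2) - ‖b‖ ^ (2 * q + 2) -
        (2 * q + 2) * ((starRingEnd ℂ) (((‖b‖ ^ (2 * q) : ℝ) : ℂ) * b) * (a - b)).re|
        ≤ M * ‖a - b‖ ^ 2) {f g : 𝓢(Space d, ℂ)}
    (hf : ∀ σ ∈ Set.Icc (0 : ℝ) 1, ∀ x, ‖U σ f x‖ ≤ R)
    (hg : ∀ σ ∈ Set.Icc (0 : ℝ) 1, ∀ x, ‖U σ g x‖ ≤ R) :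
    |avgPotential q f - avgPotential q g -
      (2 * q + 2) * (∫ x, (starRingEnd ℂ) (nonlinearity (2 * q) g x) * (f x - g x)).re| ≤
      M * ∫ x, ‖f x - g x‖ ^ 2 := by
  obtain ⟨h1, h2⟩ := re_integral_conj_nonlinearity q (f - g) g
  simp only [sub_apply] at h2
  have hcf := (continuous_potential_U q f).intervalIntegrable (μ := volume) 0 1
  have hcg := (continuous_potential_U q g).intervalIntegrable (μ := volume) 0 1
  rw [h2, avgPotential, avgPotential, ← intervalIntegral.integral_const_mul,
    ← intervalIntegral.integral_sub hcf hcg,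
    ← intervalIntegral.integral_sub (hcf.sub hcg) (h1.const_mul _)]
  have := intervalIntegral.norm_integral_le_of_norm_le_const (a := (0 : ℝ)) (b := 1)
    (f := fun σ => potential q (U σ f) - potential q (U σ g) -
      (2 * q + 2) * (ip (powS q (U σ g)) (U σ (f - g))).re)
    (C := M * ∫ x, ‖f x - g x‖ ^ 2) (fun σ hσ => ?_)
  · simpa using this
  · rw [Set.uIoc_of_le zero_le_one] at hσ
    have hσ' : σ ∈ Set.Icc (0 : ℝ) 1 := ⟨hσ.1.le, hσ.2⟩
    have h3 := abs_potential_remainder_le hM (hf σ hσ') (hg σ hσ')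
    rw [← map_sub, ip_U_U, re_ip_self] at h3
    exact h3

/-- The nonlinear part of the velocity contributes i|N|², which has zero real part. -/
lemma re_integral_conj_nonlinearity_velocity (q : ℕ) (γ : ℝ) (f : 𝓢(Space d, ℂ)) :
    (∫ x, (starRingEnd ℂ) (nonlinearity (2 * q) f x) * velocity q γ f x).re =
      γ * nlPairing q (Lap f) f := by
  obtain ⟨C, hC0, hC⟩ := (boundedFamily_const (ι := Unit) f).nonlinearity_le_weight q
  have hm := stronglyMeasurable_nonlinearity q f
  have hmc : StronglyMeasurable fun x => (starRingEnd ℂ) (nonlinearity (2 * q) f x) :=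
    Complex.continuous_conj.comp_stronglyMeasurable hm
  have hi1 : Integrable fun x => (starRingEnd ℂ) (nonlinearity (2 * q) f x) *
      nonlinearity (2 * q) f x := by
    refine integrable_mul_nonlinearity hmc (B := C) (fun x => ?_) q f
    rw [RCLike.norm_conj]
    exact (hC () x).trans (mul_le_of_le_one_right hC0 (weight_le_one x))
  obtain ⟨B, -, hB⟩ := (boundedFamily_const (ι := Unit) (conjS (Lap f))).le_const
  have hi2 := integrable_mul_nonlinearity (conjS (Lap f)).continuous.stronglyMeasurable (hB ()) q f
  have e1 : ∀ x, ((starRingEnd ℂ) (nonlinearity (2 * q) f x) * velocity q γ f x).re =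
      γ * (conjS (Lap f) x * nonlinearity (2 * q) f x).im := by
    intro x
    simp [velocity]
    ring
  have hi3 : Integrable fun x => (starRingEnd ℂ) (nonlinearity (2 * q) f x) * velocity q γ f x := by
    have h4 : Integrable fun x => (starRingEnd ℂ) (nonlinearity (2 * q) f x) * Lap f x := by
      have h5 := (Complex.conjCLE : ℂ →L[ℝ] ℂ).integrable_comp hi2
      refine h5.congr (Filter.Eventually.of_forall fun x => ?_)
      simp [mul_comm]
    refine (((h4.const_mul (γ : ℂ)).add hi1).const_mul Complex.I).congr
      (Filter.Eventually.of_forall fun x => ?_)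
    simp only [velocity, Pi.add_apply]
    ring
  rw [← im_integral_nonlinearity, ← RCLike.re_eq_complex_re, ← integral_re hi3,
    ← RCLike.im_eq_complex_im]
  erw [← integral_im hi2]
  rw [← integral_const_mul]
  congr 1; ext x
  exact e1 x

/-- The first-order expansion holds up to M‖u(t) - u(s)‖₂² = O(|t - s|²), so the slope has the limit
of the linear pairing. -/
lemma IsSolution.hasDerivAt_avgPotential {q : ℕ} {γ : ℝ} {u₀ : 𝓢(Space d, ℂ)} {I : Set ℝ}
    {u : ℝ → 𝓢(Space d, ℂ)} (hu : IsSolution (2 * q) γ u₀ I u) {s : ℝ} (hs : s ∈ I) :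
    HasDerivAt (fun t => avgPotential q (u t)) ((2 * q + 2) * (γ * nlPairing q (Lap (u s)) (u s)))
      s := by
  obtain ⟨K, hK, hsK, hb, C, hC0, hC⟩ := hu.exists_nhds hs
  have hUb : BoundedFamily fun i : K × Set.Icc (0 : ℝ) 1 => U (i.2 : ℝ) (u i.1) :=
    BoundedFamily.U (R := 1) (fun i => ⟨by linarith [i.2.2.1], i.2.2.2⟩) (hb.comp Prod.fst)
  obtain ⟨R, -, hR⟩ := hUb.le_const
  have hRt : ∀ t ∈ K, ∀ σ ∈ Set.Icc (0 : ℝ) 1, ∀ x, ‖U σ (u t) x‖ ≤ R :=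
    fun t ht σ hσ x => hR (⟨t, ht⟩, ⟨σ, hσ⟩) x
  obtain ⟨M, hM0, hM⟩ := exists_norm_pow_remainder_le R q
  obtain ⟨B, hB0, hB⟩ := (boundedFamily_const (ι := Unit) (u s)).nonlinearity_le_weight q
  have key := hu.tendsto_pairing hs
    (g := fun _ x => (starRingEnd ℂ) (nonlinearity (2 * q) (u s) x)) (B := B)
    (fun _ => (Complex.continuous_conj.comp_stronglyMeasurable
      (stronglyMeasurable_nonlinearity q (u s))).aestronglyMeasurable)
    (Filter.Eventually.of_forall fun _ x => by
      rw [RCLike.norm_conj]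
      exact (hB () x).trans (mul_le_of_le_one_right hB0 (weight_le_one x)))
    (fun x => tendsto_const_nhds)
  rw [re_integral_conj_nonlinearity_velocity] at key
  replace key := key.const_mul (2 * (q : ℝ) + 2)
  rw [hasDerivAt_iff_tendsto_slope]
  set W := ∫ x : Space d, C ^ 2 * weight x with hW
  have hrem : ∀ t ∈ K, |avgPotential q (u t) - avgPotential q (u s) - (2 * q + 2) *
      (∫ x, (starRingEnd ℂ) (nonlinearity (2 * q) (u s) x) * (u t x - u s x)).re| ≤
      M * (W * |t - s| ^ 2) := by
    intro t ht
    refine (abs_avgPotential_remainder_le hM (hRt t ht) (hRt s hsK)).trans ?_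
    gcongr
    rw [hW, ← integral_mul_const]
    refine integral_mono (integrable_norm_sq (u t - u s))
      ((integrable_weight.const_mul _).mul_const _) fun x => ?_
    calc ‖u t x - u s x‖ ^ 2 ≤ (C * weight x * |t - s|) ^ 2 := by
          gcongr; exact hC t ht x
      _ = C ^ 2 * (weight x * weight x) * |t - s| ^ 2 := by ring
      _ ≤ C ^ 2 * (weight x * 1) * |t - s| ^ 2 := by
          have := (weight_pos x).le
          have := weight_le_one x
          gcongr
      _ = _ := by rw [mul_one]
  have hzero : Filter.Tendsto (fun t => slope (fun t => avgPotential q (u t)) s t -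
      (2 * (q : ℝ) + 2) * ((t - s)⁻¹ *
      (∫ x, (starRingEnd ℂ) (nonlinearity (2 * q) (u s) x) * (u t x - u s x)).re))
      (nhdsWithin s {s}ᶜ) (nhds 0) := by
    have hlim : Filter.Tendsto (fun t => M * (W * |t - s|)) (nhdsWithin s {s}ᶜ) (nhds 0) := by
      have : Continuous fun t => M * (W * |t - s|) := by fun_prop
      have h := (this.tendsto s).mono_left (nhdsWithin_le_nhds (s := {s}ᶜ))
      simpa using h
    refine squeeze_zero_norm' ?_ hlim
    filter_upwards [nhdsWithin_le_nhds hK, self_mem_nhdsWithin] with t ht hts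
    have hts' : 0 < |t - s| := abs_pos.2 (sub_ne_zero.2 hts)
    rw [slope_def_field, div_eq_inv_mul, mul_left_comm, ← mul_sub, norm_mul, norm_inv,
      Real.norm_eq_abs, Real.norm_eq_abs, inv_mul_le_iff₀ hts']
    refine (hrem t ht).trans (le_of_eq ?_)
    ring
  have := hzero.add key
  simpa using this

/-! ### The functionals in terms of the pairing -/

lemma variance_eq (f : 𝓢(Space d, ℂ)) : variance (f : Space d → ℂ) = (ip f (sqPos f)).re := by
  rw [variance, ip, ← RCLike.re_eq_complex_re, ← integral_re (integrable_conj_mul f (sqPos f))]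
  congr 1; ext x
  rw [sqPos_apply, mul_left_comm, Complex.conj_mul', RCLike.re_eq_complex_re,
    Complex.re_ofReal_mul, ← Complex.ofReal_pow, Complex.ofReal_re]

lemma vDotOne_eq (f : 𝓢(Space d, ℂ)) :
    vDotOne (f : Space d → ℂ) = 4 * (ip f (dilation f)).re := by
  rw [re_ip_dilation, vDotOne, ip]
  congr 3; ext x
  rw [euler_eq_sum, sum_apply]
  simp [D_apply]

/-- The kinetic term `∫ |∇f|²`. -/
def kinetic (f : 𝓢(Space d, ℂ)) : ℝ := ∑ j, (ip (D j f) (D j f)).re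

lemma kinetic_nonneg (f : 𝓢(Space d, ℂ)) : 0 ≤ kinetic f :=
  Finset.sum_nonneg fun j _ => by
    rw [re_ip_self]; exact integral_nonneg fun _ => by positivity

lemma kinetic_eq (f : 𝓢(Space d, ℂ)) : kinetic f = -(ip f (Lap f)).re := by
  rw [kinetic, Lap_eq_sum, ip_sum_right, Complex.re_sum, ← Finset.sum_neg_distrib]
  refine Finset.sum_congr rfl fun j _ => ?_
  rw [ip_D, Complex.neg_re]

lemma avgPotential_nonneg (q : ℕ) (f : 𝓢(Space d, ℂ)) : 0 ≤ avgPotential q f :=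
  intervalIntegral.integral_nonneg zero_le_one fun _ _ => potential_nonneg _ _

lemma energy_eq (q : ℕ) (γ : ℝ) (f : 𝓢(Space d, ℂ)) :
    energy (2 * q) γ (f : Space d → ℂ) =
      -(γ / 2) * kinetic f + 1 / (2 * q + 2) * avgPotential q f := by
  rw [energy, integral_potential_swap, ← avgPotential, kinetic]
  congr 2
  · simp only [re_ip_self, ← D_apply]
    exact integral_finsetSum _ fun j _ => integrable_norm_sq (D j f)
  · push_cast; ring

/-! ### The nonlinear contributions -/

lemma intervalIntegrable_im_ip_Lap (q : ℕ) (f : 𝓢(Space d, ℂ)) :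
    IntervalIntegrable (fun σ => (ip (Lap (U σ f)) (powS q (U σ f))).im) volume 0 1 := by
  have h := (ip_nonlinearity q (Lap f) f).1
  simp only [U_Lap] at h
  exact ⟨h.1.im, h.2.im⟩

/-- Integration by parts against F', with σF(σ) as primitive; the boundary term at 0 vanishes. -/
lemma integral_mul_im_ip_Lap (q : ℕ) (f : 𝓢(Space d, ℂ)) :
    (2 * q + 2) * ∫ σ in (0 : ℝ)..1, σ * (ip (Lap (U σ f)) (powS q (U σ f))).im =
      potential q (U 1 f) - avgPotential q f := by
  have hL := intervalIntegrable_im_ip_Lap q f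
  have hF := (continuous_potential_U q f).intervalIntegrable (μ := volume) 0 1
  have hL1 : IntervalIntegrable (fun σ => σ * ((2 * q + 2) *
      (ip (Lap (U σ f)) (powS q (U σ f))).im)) volume 0 1 :=
    (hL.const_mul _).continuousOn_mul continuousOn_id
  have h := intervalIntegral.integral_eq_sub_of_hasDerivAt (a := (0 : ℝ)) (b := 1)
    (f := fun σ => σ * potential q (U σ f))
    (f' := fun σ => potential q (U σ f) + σ * ((2 * q + 2) *
      (ip (Lap (U σ f)) (powS q (U σ f))).im))
    (fun σ _ => by
      convert! (hasDerivAt_id σ).mul (hasDerivAt_potential_U q f σ) using 1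
      simp) (hF.add hL1)
  rw [intervalIntegral.integral_add hF hL1] at h
  rw [← intervalIntegral.integral_const_mul, avgPotential]
  simp only [mul_left_comm (2 * (q : ℝ) + 2)]
  linarith

lemma integral_sq_mul_im_ip_Lap (q : ℕ) (f : 𝓢(Space d, ℂ)) :
    (2 * q + 2) * ∫ σ in (0 : ℝ)..1, σ ^ 2 * (ip (Lap (U σ f)) (powS q (U σ f))).im =
      potential q (U 1 f) - 2 * ∫ σ in (0 : ℝ)..1, σ * potential q (U σ f) := by
  have hL := intervalIntegrable_im_ip_Lap q f
  have hF : IntervalIntegrable (fun σ => 2 * (σ * potential q (U σ f))) volume 0 1 :=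
    (continuous_const.mul (continuous_id.mul (continuous_potential_U q f))).intervalIntegrable 0 1
  have hL1 : IntervalIntegrable (fun σ => σ ^ 2 * ((2 * q + 2) *
      (ip (Lap (U σ f)) (powS q (U σ f))).im)) volume 0 1 :=
    (hL.const_mul _).continuousOn_mul (continuous_pow 2).continuousOn
  have h := intervalIntegral.integral_eq_sub_of_hasDerivAt (a := (0 : ℝ)) (b := 1)
    (f := fun σ => σ ^ 2 * potential q (U σ f))
    (f' := fun σ => 2 * (σ * potential q (U σ f)) + σ ^ 2 * ((2 * q + 2) *
      (ip (Lap (U σ f)) (powS q (U σ f))).im))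
    (fun σ _ => by
      convert! (hasDerivAt_pow 2 σ).mul (hasDerivAt_potential_U q f σ) using 1
      simp [mul_assoc])
    (hF.add hL1)
  rw [intervalIntegral.integral_add hF hL1, intervalIntegral.integral_const_mul] at h
  rw [← intervalIntegral.integral_const_mul]
  simp only [mul_left_comm (2 * (q : ℝ) + 2)]
  linarith

/-- Integrating the σ² term by parts changes the coefficient dq of ∫ σF into dq - 2 and leaves F(1).
-/
lemma nlPairing_sqPos (q : ℕ) (f : 𝓢(Space d, ℂ)) :
    nlPairing q (sqPos f) f = -(4 * (d * q - 2) * (∫ σ in (0 : ℝ)..1, σ * potential q (U σ f))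
      + 4 * potential q (U 1 f)) / (2 * q + 2) := by
  have h := integral_sq_mul_im_ip_Lap q f
  have hF : IntervalIntegrable (fun σ => σ * potential q (U σ f)) volume 0 1 :=
    (continuous_id.mul (continuous_potential_U q f)).intervalIntegrable 0 1
  have hL : IntervalIntegrable (fun σ => σ ^ 2 * (ip (Lap (U σ f)) (powS q (U σ f))).im)
      volume 0 1 :=
    (intervalIntegrable_im_ip_Lap q f).continuousOn_mul (continuous_pow 2).continuousOn
  have e : ∀ σ, (ip (U σ (sqPos f)) (powS q (U σ f))).im =
      -(4 * d * q / (2 * q + 2)) * (σ * potential q (U σ f))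
        - 4 * (σ ^ 2 * (ip (Lap (U σ f)) (powS q (U σ f))).im) := by
    intro σ; rw [im_ip_U_sqPos]; ring
  simp only [nlPairing, e]
  rw [intervalIntegral.integral_sub (hF.const_mul _) (hL.const_mul _),
    intervalIntegral.integral_const_mul, intervalIntegral.integral_const_mul]
  rw [eq_div_iff (by positivity)]
  field_simp
  linear_combination -h

lemma nlPairing_dilation (q : ℕ) (f : 𝓢(Space d, ℂ)) :
    nlPairing q (dilation f) f =
      ((d * q - 2) * avgPotential q f + 2 * potential q (U 1 f)) / (2 * q + 2) := by
  have h := integral_mul_im_ip_Lap q f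
  have hF : IntervalIntegrable (fun σ => potential q (U σ f)) volume 0 1 :=
    (continuous_potential_U q f).intervalIntegrable 0 1
  have hL : IntervalIntegrable (fun σ => σ * (ip (Lap (U σ f)) (powS q (U σ f))).im)
      volume 0 1 :=
    (intervalIntegrable_im_ip_Lap q f).continuousOn_mul continuousOn_id
  have e : ∀ σ, (ip (U σ (dilation f)) (powS q (U σ f))).im =
      (d * q / (2 * q + 2)) * potential q (U σ f)
        + 2 * (σ * (ip (Lap (U σ f)) (powS q (U σ f))).im) := by
    intro σ; rw [im_ip_U_dilation]; ring
  simp only [nlPairing, e]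
  rw [intervalIntegral.integral_add (hF.const_mul _) (hL.const_mul _),
    intervalIntegral.integral_const_mul, intervalIntegral.integral_const_mul, ← avgPotential]
  rw [eq_div_iff (by positivity)]
  field_simp
  linear_combination (2 : ℝ) * h

/-! ### The virial identities -/

section Solution

variable {q : ℕ} {γ : ℝ} {u₀ : 𝓢(Space d, ℂ)} {I : Set ℝ} {u : ℝ → 𝓢(Space d, ℂ)}

/-- Both halves are multiples of the pairing of Δu with the nonlinearity, with opposite signs; ⟨Δu,
Δu⟩ is real and drops out. -/
lemma IsSolution.hasDerivAt_energy (hu : IsSolution (2 * q) γ u₀ I u) {t : ℝ} (ht : t ∈ I) :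
    HasDerivAt (fun t => energy (2 * q) γ (u t)) 0 t := by
  have h1 := hu.hasDerivAt_quadratic ht Lap ip_Lap
  have h2 := hu.hasDerivAt_avgPotential ht
  rw [ip_self_im] at h1
  have h3 := (h1.const_mul (γ / 2)).add (h2.const_mul (1 / (2 * (q : ℝ) + 2)))
  simp only [energy_eq, kinetic_eq]
  convert! h3 using 1
  · ext s; simp
  · field_simp
    ring

lemma IsSolution.energy_eq_initial (hu : IsSolution (2 * q) γ u₀ I u) {t : ℝ} (ht : t ∈ I) :
    energy (2 * q) γ (u t) = energy (2 * q) γ u₀ := by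
  rw [← hu.initial]
  have hconv : Convex ℝ I := hu.ordConnected.convex
  refine hconv.is_const_of_fderivWithin_eq_zero (𝕜 := ℝ)
    (f := fun t => energy (2 * q) γ (u t))
    (fun s hs => (hu.hasDerivAt_energy hs).differentiableAt.differentiableWithinAt)
    (fun s hs => ?_) ht hu.zero_mem
  have := (hu.hasDerivAt_energy hs).hasFDerivAt.hasFDerivWithinAt (s := I)
  rw [this.fderivWithin (hu.isOpen.uniqueDiffWithinAt hs)]
  simp

lemma IsSolution.hasDerivAt_variance (hu : IsSolution (2 * q) γ u₀ I u) {t : ℝ} (ht : t ∈ I) :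
    HasDerivAt (fun t => variance (u t)) (γ * vDotOne (u t) +
      8 * ((d * q - 2) * (∫ σ in (0 : ℝ)..1, σ * potential q (U σ (u t))) +
        potential q (U 1 (u t))) / (2 * q + 2)) t := by
  have h1 := hu.hasDerivAt_quadratic ht sqPos ip_sqPos
  simp only [variance_eq, vDotOne_eq, re_ip_dilation]
  convert! h1 using 1
  rw [im_ip_sqPos_Lap, nlPairing_sqPos]
  ring

/-- The kinetic term is eliminated through the conserved energy, which lowers dq - 2 to dq - 4. This
is where the threshold p = 8/d arises. -/
lemma IsSolution.hasDerivAt_vDotOne (hu : IsSolution (2 * q) γ u₀ I u) {t : ℝ} (ht : t ∈ I) :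
    HasDerivAt (fun t => vDotOne (u t)) (-16 * energy (2 * q) γ u₀ -
      8 * ((d * q - 4) * avgPotential q (u t) + 2 * potential q (U 1 (u t))) / (2 * q + 2)) t := by
  have h1 := (hu.hasDerivAt_quadratic ht dilation ip_dilation).const_mul 4
  simp only [vDotOne_eq]
  convert! h1 using 1
  rw [← hu.energy_eq_initial ht, energy_eq, im_ip_dilation_Lap, ← kinetic, nlPairing_dilation]
  ring

end Solution

/-! ### The virial bounds -/

section Bounds

variable {q : ℕ} {γ : ℝ} {u₀ : 𝓢(Space d, ℂ)} {I : Set ℝ} {u : ℝ → 𝓢(Space d, ℂ)}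

lemma IsSolution.le_initial_of_hasDerivAt (hu : IsSolution (2 * q) γ u₀ I u) {φ φ' : ℝ → ℝ}
    {t : ℝ} (ht : t ∈ I) (ht0 : t ≤ 0) (hφ : ∀ s ∈ I, HasDerivAt φ (φ' s) s)
    (hnn : ∀ s ∈ I, t ≤ s → s ≤ 0 → 0 ≤ φ' s) : φ t ≤ φ 0 := by
  have hsub : Set.Icc t 0 ⊆ I := hu.ordConnected.out ht hu.zero_mem
  have hm : MonotoneOn φ (Set.Icc t 0) := by
    refine monotoneOn_of_deriv_nonneg (convex_Icc t 0)
      (fun s hs => (hφ s (hsub hs)).continuousAt.continuousWithinAt) ?_ ?_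
    · exact fun s hs => (hφ s (hsub (interior_subset hs))).differentiableAt.differentiableWithinAt
    · intro s hs
      have hs' := interior_subset hs
      rw [(hφ s (hsub hs')).deriv]
      exact hnn s (hsub hs') hs'.1 hs'.2
  exact hm (Set.left_mem_Icc.2 ht0) (Set.right_mem_Icc.2 ht0) ht0

lemma IsSolution.vDotOne_ge (hu : IsSolution (2 * q) γ u₀ I u) (hdq : 4 ≤ (d * q : ℝ)) {t : ℝ}
    (ht : t ∈ I) (ht0 : t ≤ 0) :
    vDotOne u₀ - 16 * energy (2 * q) γ u₀ * t ≤ vDotOne (u t) := by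
  have h := hu.le_initial_of_hasDerivAt ht ht0
    (φ := fun s => -(vDotOne (u s) + 16 * energy (2 * q) γ u₀ * s))
    (fun s hs => ((hu.hasDerivAt_vDotOne hs).add ((hasDerivAt_id s).const_mul _)).neg)
    (fun s hs _ _ => by
      have h1 := avgPotential_nonneg q (u s)
      have h2 := potential_nonneg q (U 1 (u s))
      have h3 : 0 ≤ 8 * ((d * q - 4) * avgPotential q (u s) + 2 * potential q (U 1 (u s))) /
          (2 * q + 2) := by
        have : 0 ≤ (d * q - 4 : ℝ) := by linarith
        positivity
      linarith)
  simp only [hu.initial] at h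
  linarith

lemma integral_mul_potential_nonneg (q : ℕ) (f : 𝓢(Space d, ℂ)) :
    0 ≤ ∫ σ in (0 : ℝ)..1, σ * potential q (U σ f) :=
  intervalIntegral.integral_nonneg zero_le_one fun _ hσ => mul_nonneg hσ.1 (potential_nonneg _ _)

lemma IsSolution.variance_le_focusing (hu : IsSolution (2 * q) 1 u₀ I u)
    (hdq : 4 ≤ (d * q : ℝ)) {t : ℝ} (ht : t ∈ I) (ht0 : t ≤ 0) :
    variance (u t) ≤ variance u₀ + vDotOne u₀ * t - 8 * energy (2 * q) 1 u₀ * t ^ 2 := by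
  have h := hu.le_initial_of_hasDerivAt ht ht0
    -- The subtracted polynomial is the primitive of the lower bound for v̇₁, vanishing at 0.
    (φ := fun s => variance (u s) - (vDotOne u₀ * s - 8 * energy (2 * q) 1 u₀ * s ^ 2))
    (fun s hs => (hu.hasDerivAt_variance hs).sub
      (((hasDerivAt_id s).const_mul _).sub ((hasDerivAt_pow 2 s).const_mul _)))
    (fun s hs _ hs0 => by
      have h0 := hu.vDotOne_ge hdq hs hs0
      have h1 := integral_mul_potential_nonneg q (u s)
      have h2 := potential_nonneg q (U 1 (u s))
      have h3 : 0 ≤ 8 * ((d * q - 2) * (∫ σ in (0 : ℝ)..1, σ * potential q (U σ (u s))) +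
          potential q (U 1 (u s))) / (2 * q + 2) := by
        have : 0 ≤ (d * q - 2 : ℝ) := by linarith
        positivity
      norm_num
      linarith)
  simp only [hu.initial] at h
  linarith

lemma IsSolution.variance_le_defocusing (hu : IsSolution (2 * q) (-1) u₀ I u)
    (hdq : 4 ≤ (d * q : ℝ)) {t : ℝ} (ht : t ∈ I) (htl : -(1 / 2 : ℝ) ≤ t) (ht0 : t ≤ 0) :
    variance (u t) ≤ variance u₀ - vDotOne u₀ * t
      + 4 * (d * q - 2) * energy (2 * q) (-1) u₀ * t ^ 2 := by
  set E := energy (2 * q) (-1) u₀ with hE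
  -- The weight s - t encodes the double time integration: this function is v(t) at s = t and the
  -- claimed right-hand side at s = 0. Its constant is half of 16 + 8(dq - 4), from bounding ∫₀¹
  -- F/(2q+2) by E.
  have h := hu.le_initial_of_hasDerivAt ht ht0
    (φ := fun s => variance (u s) + (s - t) * vDotOne (u s)
      + 4 * (d * q - 2) * E * (s - t) ^ 2)
    (fun s hs => ((hu.hasDerivAt_variance hs).add
      (((hasDerivAt_id s).sub_const t).mul (hu.hasDerivAt_vDotOne hs))).add
      ((((hasDerivAt_id s).sub_const t).pow 2).const_mul _))
    (fun s hs hts hs0 => by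
      have h1 := integral_mul_potential_nonneg q (u s)
      have h2 := potential_nonneg q (U 1 (u s))
      have h4 : avgPotential q (u s) / (2 * q + 2) ≤ E := by
        rw [hE, ← hu.energy_eq_initial hs, energy_eq]
        have := kinetic_nonneg (u s)
        rw [div_eq_inv_mul, ← one_div]
        linarith
      have hq : 0 ≤ (d * q - 2 : ℝ) := by linarith
      have h3 : 0 ≤ 8 * (d * q - 2) * (∫ σ in (0 : ℝ)..1, σ * potential q (U σ (u s))) /
          (2 * q + 2) := by positivity
      have h5 : 0 ≤ potential q (U 1 (u s)) / (2 * q + 2) := by positivity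
      have h6 : 0 ≤ (s - t) * ((d * q - 4) * (E - avgPotential q (u s) / (2 * q + 2))) :=
        mul_nonneg (by linarith) (mul_nonneg (by linarith) (by linarith))
      -- The loss 16(s - t)F(1) is absorbed by the gain 8F(1), which requires s - t ≤ 1/2 and hence
      -- t ≥ -1/2.
      have h7 : 0 ≤ (1 / 2 - (s - t)) * (potential q (U 1 (u s)) / (2 * q + 2)) :=
        mul_nonneg (by linarith) h5
      simp only [id_eq]
      norm_num
      simp only [← hE]
      have e : (-vDotOne (u s) + 8 * ((d * q - 2) *
          (∫ σ in (0 : ℝ)..1, σ * potential q (U σ (u s))) +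
            potential q (U 1 (u s))) / (2 * q + 2) +
          (vDotOne (u s) + (s - t) * (-(16 * E) - 8 * ((d * q - 4) * avgPotential q (u s) +
            2 * potential q (U 1 (u s))) / (2 * q + 2))) + 4 * (d * q - 2) * E * (2 * (s - t))) =
          8 * (d * q - 2) * (∫ σ in (0 : ℝ)..1, σ * potential q (U σ (u s))) / (2 * q + 2) +
          8 * ((s - t) * ((d * q - 4) * (E - avgPotential q (u s) / (2 * q + 2)))) +
          16 * ((1 / 2 - (s - t)) * (potential q (U 1 (u s)) / (2 * q + 2))) := by ring
      rw [e]
      positivity)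
  simp only [hu.initial] at h
  linarith

end Bounds

end GabitovTuritsyn
end

open GabitovTuritsyn in
theorem mainTheorem5 (d p : ℕ) (hd : 1 ≤ d) (hp_even : Even p) (hp_two : 2 ≤ p)
    (hp : (8 : ℝ) / d ≤ p) :
    ∃ C : ℝ, 0 < C ∧
      ∀ (u₀ : 𝓢(Space d, ℂ)) (I : Set ℝ) (u : ℝ → 𝓢(Space d, ℂ)),
        -- defocusing case
        (IsSolution p (-1) u₀ I u →
          ∀ t ∈ I, -(1 / 2 : ℝ) ≤ t → t ≤ 0 →
            variance (u t) ≤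
              variance u₀ - vDotOne u₀ * t + C * energy p (-1) u₀ * t ^ 2) ∧
        -- focusing case
        (IsSolution p 1 u₀ I u →
          ∀ t ∈ I, t < 0 →
            variance (u t) ≤
              variance u₀ + vDotOne u₀ * t - 8 * energy p 1 u₀ * t ^ 2) ∧
        -- both cases; the energy is a constant of the motion
        (∀ γ : ℝ, γ = -1 ∨ γ = 1 → IsSolution p γ u₀ I u →
          (∀ t ∈ I, energy p γ (u t) = energy p γ u₀) ∧
          ∀ t ∈ I, t < 0 → vDotOne u₀ - 16 * energy p γ u₀ * t ≤ vDotOne (u t)) := by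
  -- Evenness makes |f|^p f a polynomial in f and its conjugate, so the nonlinearity preserves
  -- Schwartz functions.
  obtain ⟨q, rfl⟩ := even_iff_exists_two_mul.1 hp_even
  have hd0 : (0 : ℝ) < d := by exact_mod_cast hd
  have hdq : 4 ≤ (d * q : ℝ) := by
    rw [div_le_iff₀ hd0] at hp
    push_cast at hp
    linarith
  refine ⟨4 * (d * q - 2), by linarith, fun u₀ I u => ⟨?_, ?_, ?_⟩⟩
  · exact fun hu t ht htl ht0 => hu.variance_le_defocusing hdq ht htl ht0
  · exact fun hu t ht ht0 => hu.variance_le_focusing hdq ht ht0.le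
  · exact fun γ _ hu => ⟨fun t ht => hu.energy_eq_initial ht,
      fun t ht ht0 => hu.vDotOne_ge hdq ht ht0.le⟩
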